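/- Let $Ax=b$ be an $m\times n$ linear system over $\mathbb Z_2$ ($m,n\ge 1$), let $V_i=\{j : A_{ij}\ne 0\}$, and let $\mathcal G$ be the associated linear system non-local game: Alice receives $i\in\{1,\dots,m\}$ and Bob receives $j\in\{1,\dots,n\}$, uniformly and independently; Alice answers $y\in\mathbb Z_2^{V_i}$ with $\sum_{k\in V_i}y_k=b_i$, Bob answers $x_j\in\mathbb Z_2$, and they win if $j\notin V_i$ or $y_j=x_j$. A (projective) quantum strategy $\mathcal S$, presented in terms of observables, consists of Hilbert spaces $H_A,H_B$, at least one of them finite-dimensional, a unit vector $|\psi\rangle\in H_A\otimes H_B$, self-adjoint operators $Y_{ij}$ ($j\in V_i$) on $H_A$ and $X_j$ on $H_B$, all squaring to $\mathbb 1$, such that for each $i$ the operators $Y_{ij}$, $j\in V_i$, commute pairwise and $\prod_{j\in V_i}Y_{ij}=(-\mathbb 1)^{b_i}$. Its dimension is $\min(\dim H_A,\dim H_B)$, and its winning probability is $\omega(\mathcal G;\mathcal S)=\frac1{mn}\sum_{i,j}p_{ij}$, where $p_{ij}=\frac12\left(1+\langle\psi|Y_{ij}\otimes X_j|\psi\rangle\right)$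 if $j\in V_i$ and $p_{ij}=1$ otherwise. Let $\omega^q(\mathcal G)$ be the supremum of $\omega(\mathcal G;\mathcal S)$ over all such strategies, and let $E(\mathcal G,\epsilon)$ be the smallest dimension of such a strategy with $\omega(\mathcal G;\mathcal S)\ge\omega^q(\mathcal G)-\epsilon$. Let $\Gamma(A,b)$ be the solution group, presented by generators $x_1,\dots,x_n,J$ and relations $J^2=e$; $x_j^2=e$ and $[x_j,J]=e$ for all $j$; $\prod_{j\in V_i}x_j=J^{b_i}$ for all $i$ (product in increasing order of $j$); and $x_jx_k=x_kx_j$ for all $i$ and $j,k\in V_i$. For a $d\times d$ matrix $M$ let $\|M\|_f=\sqrt{\mathrm{Tr}(M^*M)/d}$. For $\delta,\epsilon>0$ let $\mathrm{hlp}(J,\delta,\epsilon)\in\mathbb N\cup\{+\infty\}$ be the smallest $d\ge1$ for which there is a homomorphism $\phi$ from the free group on $x_1,\dots,x_n,J$ to the unitary group of $\mathbb C^d$ with $\|\phi(r)-\mathbb 1\|_f\le\epsilon$ for each of these defining relations, written as a word $r$ (a relation $u=v$ giving $r=uv^{-1}$), and with $\|\phi(J)-\mathbb 1\|_f\ge\delta$;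 it is $+\infty$ if there is no such $d$. If $\omega^q(\mathcal G)=1$, then there are constants $C\ge C'>0$, depending on $\mathcal G$, such that for all $\epsilon>0$ $$\mathrm{hlp}(J,2,C\epsilon^{1/4})\le E(\mathcal G,\epsilon)\le \mathrm{hlp}(J,2,C'\sqrt\epsilon).$$ -/

import Mathlib

open scoped TensorProduct Matrix

noncomputable section

/-- The normalized Frobenius norm `√(Tr(M* M) / d)` of a `d × d` complex matrix. -/
def normalizedFrobeniusNorm {d : ℕ} (M : Matrix (Fin d) (Fin d) ℂ) : ℝ :=
  Real.sqrt ((Matrix.trace (Mᴴ * M)).re / d)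

/-- `φ : F(S) → U(ℂ^d)` is an `ε`-representation of the presentation `⟨S : R⟩`: every relator is
sent within distance `ε` of the identity in the normalized Frobenius norm. -/
def IsApproxRep {S : Type} (R : Set (FreeGroup S)) (ε : ℝ) {d : ℕ}
    (φ : FreeGroup S →* Matrix.unitaryGroup (Fin d) ℂ) : Prop :=
  ∀ r ∈ R, normalizedFrobeniusNorm ((φ r : Matrix (Fin d) (Fin d) ℂ) - 1) ≤ ε

/-- The hyperlinear profile `hlp(T; δ, ε)` with respect to the presentation `⟨S : R⟩`: the smallest
dimension `d ≥ 1` of an `ε`-representation `φ` such that `‖φ(w) - 1‖_f ≥ δ` for all `w ∈ T`, and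
`+∞` if there is none. -/
def hyperlinearProfile {S : Type} (R : Set (FreeGroup S)) (T : Finset (FreeGroup S))
    (δ ε : ℝ) : ℕ∞ :=
  sInf {D : ℕ∞ | ∃ d : ℕ, 0 < d ∧ D = d ∧
    ∃ φ : FreeGroup S →* Matrix.unitaryGroup (Fin d) ℂ, IsApproxRep R ε φ ∧
      ∀ w ∈ T, δ ≤ normalizedFrobeniusNorm ((φ w : Matrix (Fin d) (Fin d) ℂ) - 1)}

namespace LinearSystem

variable {m n : ℕ}

/-- The indices of the variables that appear in equation `i` of `A x = b`, in increasing order. -/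
def support (A : Matrix (Fin m) (Fin n) (ZMod 2)) (i : Fin m) : List (Fin n) :=
  (List.finRange n).filter (fun j => A i j ≠ 0)

/-- The generator `x_j` of the solution group, as a word. -/
def genX (j : Fin n) : FreeGroup (Option (Fin n)) := FreeGroup.of (some j)

/-- The generator `J` of the solution group, as a word. -/
def genJ (n : ℕ) : FreeGroup (Option (Fin n)) := FreeGroup.of none

/-- The defining relators of the solution group `Γ(A, b)`, on the generators `x_1, …, x_n, J`;
a relation `u = v` is recorded as the relator `u v⁻¹`. -/
inductive IsRelator (A : Matrix (Fin m) (Fin n) (ZMod 2)) (b : Fin m → ZMod 2) :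
    FreeGroup (Option (Fin n)) → Prop
  | J_sq : IsRelator A b (genJ n ^ 2)
  | x_comm_J (j : Fin n) : IsRelator A b (genX j * genJ n * (genX j)⁻¹ * (genJ n)⁻¹)
  | x_sq (j : Fin n) : IsRelator A b (genX j ^ 2)
  | equation (i : Fin m) :
      IsRelator A b (((support A i).map genX).prod * (genJ n ^ (b i).val)⁻¹)
  | x_comm_x (i : Fin m) (j k : Fin n) (hj : A i j ≠ 0) (hk : A i k ≠ 0) :
      IsRelator A b (genX j * genX k * (genX j)⁻¹ * (genX k)⁻¹)

/-- The relators of the solution group `Γ(A, b)`, as a set. -/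
def solutionRelators (A : Matrix (Fin m) (Fin n) (ZMod 2)) (b : Fin m → ZMod 2) :
    Set (FreeGroup (Option (Fin n))) :=
  {r | IsRelator A b r}

/-- The solution group `Γ(A, b)`. -/
abbrev SolutionGroup (A : Matrix (Fin m) (Fin n) (ZMod 2)) (b : Fin m → ZMod 2) : Type :=
  PresentedGroup (solutionRelators A b)

/-- A `{±1}`-valued observable on a Hilbert space. -/
structure IsObservable {H : Type} [NormedAddCommGroup H] [InnerProductSpace ℂ H] [CompleteSpace H]
    (X : H →L[ℂ] H) : Prop where
  isSelfAdjoint : IsSelfAdjoint X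
  sq_eq_one : X * X = 1

/-- A quantum strategy, presented in terms of observables, for the linear system game of `A x = b`,
on Hilbert spaces `HA` and `HB`. Only the operators `Y i j` with `A i j ≠ 0` are part of the
strategy: for other `j` the value `Y i j` is unconstrained and never used. When one of the spaces
is finite-dimensional, the algebraic tensor product is the Hilbert space tensor product. -/
structure Strategy (A : Matrix (Fin m) (Fin n) (ZMod 2)) (b : Fin m → ZMod 2) (HA HB : Type)
    [NormedAddCommGroup HA] [InnerProductSpace ℂ HA] [CompleteSpace HA]
    [NormedAddCommGroup HB] [InnerProductSpace ℂ HB] [CompleteSpace HB] where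
  ψ : HA ⊗[ℂ] HB
  norm_ψ : ‖ψ‖ = 1
  Y : Fin m → Fin n → (HA →L[ℂ] HA)
  X : Fin n → (HB →L[ℂ] HB)
  Y_observable : ∀ i j, A i j ≠ 0 → IsObservable (Y i j)
  Y_prod : ∀ i, ((support A i).map (Y i)).prod = (-1) ^ (b i).val
  Y_comm : ∀ i j k, A i j ≠ 0 → A i k ≠ 0 → Y i j * Y i k = Y i k * Y i j
  X_observable : ∀ j, IsObservable (X j)

section

variable {A : Matrix (Fin m) (Fin n) (ZMod 2)} {b : Fin m → ZMod 2} {HA HB : Type}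
  [NormedAddCommGroup HA] [InnerProductSpace ℂ HA] [CompleteSpace HA]
  [NormedAddCommGroup HB] [InnerProductSpace ℂ HB] [CompleteSpace HB]

/-- The success bias `⟨ψ| Y_ij ⊗ X_j |ψ⟩` on inputs `(i, j)` (a real number, since
`Y_ij ⊗ X_j` is self-adjoint). -/
def Strategy.bias (S : Strategy A b HA HB) (i : Fin m) (j : Fin n) : ℝ :=
  (inner ℂ S.ψ (TensorProduct.mapL (S.Y i j) (S.X j) S.ψ)).re

/-- The probability of winning on inputs `(i, j)`: the players always win if the variable `j` does
not appear in equation `i`. -/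
def Strategy.winProbOn (S : Strategy A b HA HB) (i : Fin m) (j : Fin n) : ℝ :=
  if A i j ≠ 0 then (S.bias i j + 1) / 2 else 1

/-- The winning probability `ω(G; S)`; the inputs `i` and `j` are uniform and independent. -/
def Strategy.winProb (S : Strategy A b HA HB) : ℝ :=
  (∑ i, ∑ j, S.winProbOn i j) / (m * n)

end

/-- The dimension of a vector space, as an element of `ℕ ∪ {∞}`. -/
def edim (H : Type) [AddCommGroup H] [Module ℂ H] : ℕ∞ := Cardinal.toENat (Module.rank ℂ H)

/-- `IsAchievable A b d p` means that the linear system game of `A x = b` has a finite-dimensional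
quantum strategy (one of `HA`, `HB` is finite-dimensional) of dimension `d = min (dim HA) (dim HB)`
with winning probability `p`. -/
def IsAchievable (A : Matrix (Fin m) (Fin n) (ZMod 2)) (b : Fin m → ZMod 2) (d : ℕ) (p : ℝ) :
    Prop :=
  ∃ (HA HB : Type) (_ : NormedAddCommGroup HA) (_ : InnerProductSpace ℂ HA) (_ : CompleteSpace HA)
    (_ : NormedAddCommGroup HB) (_ : InnerProductSpace ℂ HB) (_ : CompleteSpace HB)
    (S : Strategy A b HA HB), min (edim HA) (edim HB) = d ∧ S.winProb = p

/-- The quantum value `ω^q(G)` of the linear system game of `A x = b`. -/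
def quantumValue (A : Matrix (Fin m) (Fin n) (ZMod 2)) (b : Fin m → ZMod 2) : ℝ :=
  sSup {p : ℝ | ∃ d : ℕ, IsAchievable A b d p}

/-- The entanglement requirement `E(G, ε)`: the smallest dimension of a quantum strategy with
winning probability at least `ω^q(G) - ε`. -/
def entanglement (A : Matrix (Fin m) (Fin n) (ZMod 2)) (b : Fin m → ZMod 2) (ε : ℝ) : ℕ∞ :=
  sInf {D : ℕ∞ | ∃ d : ℕ, D = d ∧ ∃ p : ℝ, IsAchievable A b d p ∧ quantumValue A b - ε ≤ p}

end LinearSystem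

end

/-! Both bounds pass through involutions that approximately satisfy the relations of `Γ(A, b)` with
`J = -1`.

Upper bound. By the parallelogram law, a unitary at normalized distance at least 2 from the identity
is `-1`, so an approximate representation with `δ = 2` sends `J` exactly to `-1`. Its images of the
`x_j` are moved to nearby involutions `W_j`. For each equation separately, the relations of `ℤ₂ ^ r`
are stable in the Frobenius norm with constants independent of the dimension
(`exists_involutions_of_equation`), which gives Alice exact solutions `Y_ij` near `W_j`. On the
maximally entangled state with Bob playing `W_jᵀ`, the bias is `tr (Y_ij W_j) / d = 1 - ‖Y_ij -
W_j‖² / (2d)`. The loss is quadratic in the error, hence `√ε`.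

Lower bound. If a strategy wins with probability at least `1 - ε`, every bias is at least `1 - δ`
with `δ = O(ε)`. Take the tensor factor of smaller dimension, and one involution on it for each
variable. Two facts hold in the Schmidt basis of the state. (a) A perfectly correlated observable
commutes with the reduced density matrix; approximately, its entries between different Schmidt
weights are small on average, with error `O(√δ)` (`sum_max_schmidt_le`). (b) Operators can be
carried to the other tensor factor one letter at a time, so the relators hold approximately on the
state (`norm_word_sub_reverse_le`). The state need not be maximally entangled, so its weights are
cut into superlevel sets. By the layer-cake formula some superlevel set is almost invariant under
all the involutions and almost satisfies all the relations, with errors relative to its cardinality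
(`exists_superlevel_set`). Compressing to the span of those basis vectors and taking signs gives
genuine involutions, in no larger dimension (`exists_rounded_involutions`). Squared errors of order
`√ε` become norm errors of order `ε^(1/4)`. -/

noncomputable section

/-! ### Frobenius norm, Hermitian involutions and the sign of a Hermitian matrix. -/

section FrobeniusNorm

attribute [local instance] Matrix.frobeniusNormedAddCommGroup Matrix.frobeniusNormedSpace

variable {ι κ μ : Type*} [Fintype ι] [Fintype κ] [Fintype μ]

theorem frobenius_norm_sq (M : Matrix ι κ ℂ) : ‖M‖ ^ 2 = ∑ i, ∑ j, ‖M i j‖ ^ 2 := by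
  rw [Matrix.frobenius_norm_def, ← Real.sqrt_eq_rpow, Real.sq_sqrt (by positivity)]
  simp

theorem frobenius_norm_sq_eq_trace (M : Matrix ι κ ℂ) : ‖M‖ ^ 2 = (Mᴴ * M).trace.re := by
  rw [frobenius_norm_sq, Finset.sum_comm]
  simp only [Matrix.trace, Matrix.diag_apply, Matrix.mul_apply, Matrix.conjTranspose_apply,
    Complex.re_sum]
  refine Finset.sum_congr rfl fun j _ => Finset.sum_congr rfl fun i _ => ?_
  rw [← Complex.normSq_eq_norm_sq, Complex.normSq_apply]
  simp

theorem normalizedFrobeniusNorm_eq {d : ℕ} (M : Matrix (Fin d) (Fin d) ℂ) :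
    normalizedFrobeniusNorm M = ‖M‖ / √d := by
  rw [normalizedFrobeniusNorm, ← frobenius_norm_sq_eq_trace, Real.sqrt_div (by positivity),
    Real.sqrt_sq (norm_nonneg _)]

theorem frobenius_norm_isometry_mul [DecidableEq κ] {U : Matrix ι κ ℂ} (hU : Uᴴ * U = 1)
    (M : Matrix κ μ ℂ) : ‖U * M‖ = ‖M‖ := by
  have h : ‖U * M‖ ^ 2 = ‖M‖ ^ 2 := by
    rw [frobenius_norm_sq_eq_trace, frobenius_norm_sq_eq_trace, Matrix.conjTranspose_mul,
      Matrix.mul_assoc, ← Matrix.mul_assoc Uᴴ, hU, Matrix.one_mul]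
  exact (pow_left_inj₀ (norm_nonneg _) (norm_nonneg _) two_ne_zero).1 h

theorem frobenius_norm_mul_coisometry [DecidableEq κ] {U : Matrix κ ι ℂ} (hU : U * Uᴴ = 1)
    (M : Matrix μ κ ℂ) : ‖M * U‖ = ‖M‖ := by
  rw [← Matrix.frobenius_norm_conjTranspose, Matrix.conjTranspose_mul,
    frobenius_norm_isometry_mul (by simpa using hU), Matrix.frobenius_norm_conjTranspose]

theorem frobenius_norm_one [DecidableEq ι] : ‖(1 : Matrix ι ι ℂ)‖ = √(Fintype.card ι) := by
  rw [← Real.sqrt_sq (norm_nonneg (1 : Matrix ι ι ℂ)), frobenius_norm_sq_eq_trace]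
  simp

variable [DecidableEq ι]

/-- A Hermitian matrix squaring to the identity. -/
structure IsHermitianInvolution (U : Matrix ι ι ℂ) : Prop where
  isHermitian : U.IsHermitian
  mul_self : U * U = 1

namespace IsHermitianInvolution

variable {U V : Matrix ι ι ℂ}

theorem conjTranspose_mul_self (h : IsHermitianInvolution U) : Uᴴ * U = 1 := by
  rw [h.isHermitian.eq, h.mul_self]

theorem mul_conjTranspose_self (h : IsHermitianInvolution U) : U * Uᴴ = 1 := by
  rw [h.isHermitian.eq, h.mul_self]

theorem norm_mul (h : IsHermitianInvolution U) (M : Matrix ι κ ℂ) : ‖U * M‖ = ‖M‖ :=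
  frobenius_norm_isometry_mul h.conjTranspose_mul_self M

theorem norm_mul_right (h : IsHermitianInvolution U) (M : Matrix κ ι ℂ) : ‖M * U‖ = ‖M‖ :=
  frobenius_norm_mul_coisometry h.mul_conjTranspose_self M

theorem one : IsHermitianInvolution (1 : Matrix ι ι ℂ) :=
  ⟨Matrix.isHermitian_one, one_mul 1⟩

theorem neg (h : IsHermitianInvolution U) : IsHermitianInvolution (-U) :=
  ⟨h.isHermitian.neg, by rw [neg_mul_neg, h.mul_self]⟩

theorem mul (hU : IsHermitianInvolution U) (hV : IsHermitianInvolution V) (h : U * V = V * U) :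
    IsHermitianInvolution (U * V) := by
  refine ⟨?_, ?_⟩
  · rw [Matrix.IsHermitian, Matrix.conjTranspose_mul, hU.isHermitian.eq, hV.isHermitian.eq, h]
  · calc U * V * (U * V) = U * (V * U) * V := by noncomm_ring
      _ = (U * U) * (V * V) := by rw [← h]; noncomm_ring
      _ = 1 := by rw [hU.mul_self, hV.mul_self, one_mul]

theorem transpose (h : IsHermitianInvolution U) : IsHermitianInvolution Uᵀ :=
  ⟨h.isHermitian.transpose, by rw [← Matrix.transpose_mul, h.mul_self, Matrix.transpose_one]⟩

end IsHermitianInvolution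

/-- The sign of a Hermitian matrix: an involution in its bicommutant, at distance at most
`‖h ^ 2 - 1‖`. -/
theorem exists_involution_near_hermitian {h : Matrix ι ι ℂ} (hh : h.IsHermitian) :
    ∃ U : Matrix ι ι ℂ, IsHermitianInvolution U ∧ (∀ T, T * h = h * T → T * U = U * T) ∧
      ‖U - h‖ ≤ ‖h * h - 1‖ := by
  set W : Matrix ι ι ℂ := (hh.eigenvectorUnitary : Matrix ι ι ℂ) with hW
  have hW1 : Wᴴ * W = 1 := Unitary.coe_star_mul_self hh.eigenvectorUnitary
  have hW2 : W * Wᴴ = 1 := Unitary.coe_mul_star_self hh.eigenvectorUnitary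
  set D : Matrix ι ι ℂ := Matrix.diagonal (fun i => (hh.eigenvalues i : ℂ)) with hD
  have hspec : h = W * D * Wᴴ := by
    have := hh.spectral_theorem
    rw [Unitary.conjStarAlgAut_apply] at this
    exact this
  let s : ι → ℝ := fun i => if 0 ≤ hh.eigenvalues i then 1 else -1
  have hs2 : ∀ i, s i * s i = 1 := fun i => by by_cases hi : 0 ≤ hh.eigenvalues i <;> simp [s, hi]
  set E : Matrix ι ι ℂ := Matrix.diagonal (fun i => (s i : ℂ)) with hE
  have hEE : E * E = 1 := by
    rw [hE, Matrix.diagonal_mul_diagonal, ← Matrix.diagonal_one]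
    congr 1; ext i; exact_mod_cast hs2 i
  have hEH : Eᴴ = E := by
    rw [hE, Matrix.diagonal_conjTranspose]
    congr 1; ext i; simp
  have conj_mul : ∀ P Q : Matrix ι ι ℂ, W * P * Wᴴ * (W * Q * Wᴴ) = W * (P * Q) * Wᴴ := by
    intro P Q
    calc W * P * Wᴴ * (W * Q * Wᴴ) = W * P * (Wᴴ * W) * Q * Wᴴ := by noncomm_ring
      _ = _ := by rw [hW1]; noncomm_ring
  have norm_conj : ∀ P : Matrix ι ι ℂ, ‖W * P * Wᴴ‖ = ‖P‖ := by
    intro P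
    rw [frobenius_norm_mul_coisometry (by simpa using hW1), frobenius_norm_isometry_mul hW1]
  refine ⟨W * E * Wᴴ, ⟨?_, ?_⟩, ?_, ?_⟩
  · simp [Matrix.IsHermitian, Matrix.conjTranspose_mul, hEH, Matrix.mul_assoc]
  · rw [conj_mul, hEE, Matrix.mul_one, hW2]
  · intro T hT
    have hTT : T = W * (Wᴴ * T * W) * Wᴴ := by
      calc T = (W * Wᴴ) * T * (W * Wᴴ) := by rw [hW2, one_mul, mul_one]
        _ = _ := by noncomm_ring
    set T' := Wᴴ * T * W with hT'
    have h1 : T' * D = D * T' := by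
      calc T' * D = Wᴴ * (T * (W * D * Wᴴ)) * W := by
            rw [hT']
            calc Wᴴ * T * W * D = Wᴴ * T * W * D * (Wᴴ * W) := by rw [hW1, mul_one]
              _ = _ := by noncomm_ring
        _ = Wᴴ * (W * D * Wᴴ * T) * W := by rw [← hspec, hT]
        _ = (Wᴴ * W) * D * Wᴴ * T * W := by noncomm_ring
        _ = _ := by rw [hW1, hT']; noncomm_ring
    -- In the eigenbasis, commuting with `D` kills the entries of `T'` between distinct eigenvalues,
    -- and `E` is a function of the eigenvalue.
    have h2 : T' * E = E * T' := by
      ext i j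
      have h3 := congrFun (congrFun h1 i) j
      rw [hD, Matrix.mul_diagonal, Matrix.diagonal_mul] at h3
      rw [hE, Matrix.mul_diagonal, Matrix.diagonal_mul]
      by_cases hij : hh.eigenvalues i = hh.eigenvalues j
      · simp only [s, hij]; ring
      · have : T' i j = 0 := by
          have h4 : T' i j * ((hh.eigenvalues j : ℂ) - hh.eigenvalues i) = 0 := by
            linear_combination h3
          rcases mul_eq_zero.1 h4 with h5 | h5
          · exact h5
          · exact absurd (by exact_mod_cast (sub_eq_zero.1 h5).symm) hij
        simp [this]
    rw [hTT, conj_mul, conj_mul, h2]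
  · have e1 : W * E * Wᴴ - h = W * (E - D) * Wᴴ := by
      conv_lhs => rw [hspec]
      noncomm_ring
    have e2 : h * h - 1 = W * (D * D - 1) * Wᴴ := by
      conv_lhs => rw [hspec, conj_mul, ← hW2]
      noncomm_ring
    rw [e1, e2, norm_conj, norm_conj]
    refine le_of_sq_le_sq ?_ (norm_nonneg _)
    rw [frobenius_norm_sq, frobenius_norm_sq]
    refine Finset.sum_le_sum fun i _ => Finset.sum_le_sum fun j _ => ?_
    rw [hE, hD, Matrix.diagonal_mul_diagonal, ← Matrix.diagonal_one, Matrix.diagonal_sub,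
      Matrix.diagonal_sub]
    by_cases hij : i = j
    · subst hij
      rw [Matrix.diagonal_apply_eq, Matrix.diagonal_apply_eq]
      norm_cast
      rw [Real.norm_eq_abs, Real.norm_eq_abs, sq_abs, sq_abs]
      -- With `s = ±1` the sign of `λ`, `|λ² - 1| = |λ - s| |λ + s|` and `|λ + s| ≥ 1`.
      by_cases hi : 0 ≤ hh.eigenvalues i
      · simp only [s, hi, if_true]
        nlinarith [mul_nonneg (sq_nonneg (1 - hh.eigenvalues i))
          (by nlinarith : 0 ≤ hh.eigenvalues i * (hh.eigenvalues i + 2))]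
      · simp only [s, hi, if_false]
        push Not at hi
        nlinarith [mul_nonneg (sq_nonneg (1 + hh.eigenvalues i))
          (by nlinarith : 0 ≤ hh.eigenvalues i * (hh.eigenvalues i - 2))]
    · simp [Matrix.diagonal_apply_ne _ hij]

end FrobeniusNorm

/-! ### Dimension-free stability of the relations of one equation. -/

section Stability

attribute [local instance] Matrix.frobeniusNormedAddCommGroup Matrix.frobeniusNormedSpace

variable {ι : Type*} [Fintype ι] [DecidableEq ι]

/-- Averaging over the group generated by commuting involutions almost commuting with `W`. -/
theorem exists_pinching {κ : ℝ} {W : Matrix ι ι ℂ} (hW : IsHermitianInvolution W)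
    (L : List (Matrix ι ι ℂ)) (hL : ∀ Y ∈ L, IsHermitianInvolution Y)
    (hcomm : ∀ Y ∈ L, ∀ Z ∈ L, Y * Z = Z * Y) (hκ : ∀ Y ∈ L, ‖Y * W - W * Y‖ ≤ κ) :
    ∃ T : Matrix ι ι ℂ, T.IsHermitian ∧ (∀ M : Matrix ι ι ℂ, ‖T * M‖ ≤ ‖M‖) ∧
      (∀ Y ∈ L, Y * T = T * Y) ∧ ‖T - W‖ ≤ L.length * (κ / 2) := by
  induction L with
  | nil => exact ⟨W, hW.isHermitian, fun M => (hW.norm_mul M).le, by simp, by simp⟩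
  | cons Y L ih =>
    obtain ⟨T, hT, hTc, hTL, hTW⟩ := ih (fun Z hZ => hL Z (List.mem_cons_of_mem _ hZ))
      (fun Z hZ Z' hZ' => hcomm Z (List.mem_cons_of_mem _ hZ) Z' (List.mem_cons_of_mem _ hZ'))
      (fun Z hZ => hκ Z (List.mem_cons_of_mem _ hZ))
    have hY := hL Y List.mem_cons_self
    have half : ‖(1 / 2 : ℂ)‖ = 1 / 2 := by norm_num
    -- Averaging over conjugation by `Y` forces commutation with `Y` and, since the list commutes,
    -- keeps the commutations already obtained. The distance to `W` grows by half of `‖YW - WY‖`.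
    refine ⟨(1 / 2 : ℂ) • (T + Y * T * Y), ?_, ?_, ?_, ?_⟩
    · rw [Matrix.IsHermitian, Matrix.conjTranspose_smul, Matrix.conjTranspose_add,
        Matrix.conjTranspose_mul, Matrix.conjTranspose_mul, hY.isHermitian.eq, hT.eq]
      simp [Matrix.mul_assoc]
    · intro M
      rw [Matrix.smul_mul, norm_smul, half, add_mul]
      have h1 := norm_add_le (T * M) (Y * T * Y * M)
      have h2 := hTc M
      have h3 : ‖Y * T * Y * M‖ ≤ ‖M‖ := by
        rw [Matrix.mul_assoc, Matrix.mul_assoc, hY.norm_mul]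
        exact (hTc _).trans (hY.norm_mul M).le
      linarith
    · intro Z hZ
      rw [Matrix.mul_smul, Matrix.smul_mul]
      congr 1
      rcases List.mem_cons.1 hZ with rfl | hZL
      · calc Z * (T + Z * T * Z) = Z * T + (Z * Z) * T * Z := by noncomm_ring
          _ = T * Z + Z * T * (Z * Z) := by rw [hY.mul_self]; noncomm_ring
          _ = _ := by noncomm_ring
      · have h1 := hTL Z hZL
        have h2 := hcomm Z hZ Y List.mem_cons_self
        calc Z * (T + Y * T * Y) = Z * T + (Z * Y) * T * Y := by noncomm_ring
          _ = T * Z + Y * (T * Z) * Y := by rw [h2, Matrix.mul_assoc Y Z T, h1]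
          _ = T * Z + Y * T * (Z * Y) := by noncomm_ring
          _ = _ := by rw [h2]; noncomm_ring
    · have h1 : (1 / 2 : ℂ) • (T + Y * T * Y) - W =
          (1 / 2 : ℂ) • ((T - W) + Y * (T - W) * Y + (Y * W - W * Y) * Y) := by
        have : (Y * W - W * Y) * Y = Y * W * Y - W := by
          rw [sub_mul, Matrix.mul_assoc W Y Y, hY.mul_self, mul_one]
        rw [this]
        simp only [mul_sub, sub_mul, smul_add, smul_sub]
        module
      rw [h1, norm_smul, half]
      have h2 := norm_add₃_le (a := T - W) (b := Y * (T - W) * Y) (c := (Y * W - W * Y) * Y)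
      rw [hY.norm_mul_right, hY.norm_mul_right, hY.norm_mul] at h2
      have h3 := hκ Y List.mem_cons_self
      rw [List.length_cons]
      push_cast
      linarith

/-- The pinching `T` of `W` has the right commutant but is no longer an involution. Since `T` is a
contraction, `T² - 1 = T(T - W) + (T - W)W` has norm at most `2‖T - W‖`, so the sign of `T`, which
lies in its bicommutant, is within `3‖T - W‖` of `W`. -/
theorem exists_involution_commuting {κ : ℝ} {W : Matrix ι ι ℂ} (hW : IsHermitianInvolution W)
    (L : List (Matrix ι ι ℂ)) (hL : ∀ Y ∈ L, IsHermitianInvolution Y)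
    (hcomm : ∀ Y ∈ L, ∀ Z ∈ L, Y * Z = Z * Y) (hκ : ∀ Y ∈ L, ‖Y * W - W * Y‖ ≤ κ) :
    ∃ U : Matrix ι ι ℂ, IsHermitianInvolution U ∧
      (∀ Y ∈ L, Y * U = U * Y) ∧ ‖U - W‖ ≤ 3 / 2 * L.length * κ := by
  obtain ⟨T, hT, hTc, hTL, hTW⟩ := exists_pinching hW L hL hcomm hκ
  obtain ⟨U, hU, hUc, hUT⟩ := exists_involution_near_hermitian hT
  refine ⟨U, hU, fun Y hY => hUc Y (hTL Y hY), ?_⟩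
  have h1 : T * T - 1 = T * (T - W) + (T - W) * W := by
    rw [mul_sub, sub_mul, hW.mul_self]; noncomm_ring
  have h2 : ‖T * T - 1‖ ≤ ‖T - W‖ + ‖T - W‖ := by
    rw [h1]
    refine (norm_add_le _ _).trans (add_le_add (hTc _) (hW.norm_mul_right _).le)
  have h3 := norm_sub_le_norm_sub_add_norm_sub U T W
  linarith

/-- The constant in the stability of the relations of `ℤ₂ ^ r`. -/
def stabilityConst : ℕ → ℝ
  | 0 => 0
  | r + 1 => stabilityConst r + 3 / 2 * r * (1 + 2 * stabilityConst r)

theorem stabilityConst_nonneg : ∀ r, 0 ≤ stabilityConst r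
  | 0 => le_rfl
  | r + 1 => by have := stabilityConst_nonneg r; rw [stabilityConst]; positivity

theorem stabilityConst_mono : Monotone stabilityConst :=
  monotone_nat_of_le_succ fun r => by
    have := stabilityConst_nonneg r
    rw [stabilityConst]
    have : 0 ≤ 3 / 2 * r * (1 + 2 * stabilityConst r) := by positivity
    linarith

/-- Almost commuting involutions are near commuting involutions. -/
theorem exists_commuting_involutions {α : Type*} [DecidableEq α] {κ : ℝ} (hκ0 : 0 ≤ κ)
    (W : α → Matrix ι ι ℂ) (hW : ∀ j, IsHermitianInvolution (W j)) (L : List α) (hL : L.Nodup)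
    (hκ : ∀ j ∈ L, ∀ k ∈ L, ‖W j * W k - W k * W j‖ ≤ κ) :
    ∃ Y : α → Matrix ι ι ℂ, (∀ j, IsHermitianInvolution (Y j)) ∧
      (∀ j ∈ L, ∀ k ∈ L, Y j * Y k = Y k * Y j) ∧
      ∀ j ∈ L, ‖Y j - W j‖ ≤ stabilityConst L.length * κ := by
  induction L with
  | nil => exact ⟨W, hW, by simp, by simp⟩
  | cons a L ih =>
    obtain ⟨haL, hL'⟩ := List.nodup_cons.1 hL
    obtain ⟨Y, hY, hYc, hYW⟩ := ih hL' (fun j hj k hk =>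
      hκ j (List.mem_cons_of_mem _ hj) k (List.mem_cons_of_mem _ hk))
    set c := stabilityConst L.length with hc
    have hc0 : 0 ≤ c := stabilityConst_nonneg _
    -- The tail is already corrected. Replacing `W j` by `Y j` on both sides of the commutator costs
    -- `2cκ`.
    have hcom : ∀ j ∈ L, ‖Y j * W a - W a * Y j‖ ≤ (1 + 2 * c) * κ := by
      intro j hj
      have e : Y j * W a - W a * Y j =
          (Y j - W j) * W a + (W j * W a - W a * W j) + W a * (W j - Y j) := by noncomm_ring
      have h1 := norm_add₃_le (a := (Y j - W j) * W a) (b := W j * W a - W a * W j)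
        (c := W a * (W j - Y j))
      rw [← e, (hW a).norm_mul, (hW a).norm_mul_right, norm_sub_rev (W j)] at h1
      have h2 := hYW j hj
      have h3 := hκ j (List.mem_cons_of_mem _ hj) a List.mem_cons_self
      linarith
    obtain ⟨U, hU, hUc, hUW⟩ := exists_involution_commuting (κ := (1 + 2 * c) * κ) (hW a)
      (L.map Y) (by simpa using fun j _ => hY j)
      (by simpa using hYc) (by simpa using hcom)
    rw [List.length_map] at hUW
    have hne : ∀ j ∈ L, j ≠ a := fun j hj h => haL (h ▸ hj)
    refine ⟨Function.update Y a U, ?_, ?_, ?_⟩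
    · intro j
      by_cases hj : j = a
      · subst hj; simpa using hU
      · simpa [hj] using hY j
    · intro j hj k hk
      rcases List.mem_cons.1 hj with rfl | hj' <;> rcases List.mem_cons.1 hk with rfl | hk'
      · rfl
      · rw [Function.update_self, Function.update_of_ne (hne k hk')]
        exact (hUc _ (List.mem_map_of_mem hk')).symm
      · rw [Function.update_self, Function.update_of_ne (hne j hj')]
        exact hUc _ (List.mem_map_of_mem hj')
      · rw [Function.update_of_ne (hne k hk'), Function.update_of_ne (hne j hj')]
        exact hYc j hj' k hk'
    · intro j hj
      rw [List.length_cons, stabilityConst, ← hc]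
      rcases List.mem_cons.1 hj with rfl | hj
      · rw [Function.update_self]
        nlinarith [mul_nonneg hc0 hκ0]
      · rw [Function.update_of_ne (hne j hj)]
        have : 0 ≤ 3 / 2 * L.length * (1 + 2 * c) * κ := by positivity
        have := hYW j hj
        linarith

theorem list_prod_mem_involution {α : Type*} (Y : α → Matrix ι ι ℂ)
    (hY : ∀ j, IsHermitianInvolution (Y j)) (L : List α)
    (hc : ∀ j ∈ L, ∀ k ∈ L, Y j * Y k = Y k * Y j) :
    IsHermitianInvolution (L.map Y).prod := by
  induction L with
  | nil => simpa using IsHermitianInvolution.one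
  | cons a L ih =>
    rw [List.map_cons, List.prod_cons]
    refine (hY a).mul (ih fun j hj k hk =>
      hc j (List.mem_cons_of_mem _ hj) k (List.mem_cons_of_mem _ hk)) ?_
    refine (Commute.list_prod_right _ _ ?_).eq
    intro x hx
    obtain ⟨j, hj, rfl⟩ := List.mem_map.1 hx
    exact hc a List.mem_cons_self j (List.mem_cons_of_mem _ hj)

/-- Products of unitaries are Lipschitz in the factors. -/
theorem norm_list_prod_sub_le {α : Type*} {δ : ℝ} (Y W : α → Matrix ι ι ℂ) (L : List α)
    (hY : ∀ j ∈ L, (Y j)ᴴ * Y j = 1) (hW : ∀ j ∈ L, W j * (W j)ᴴ = 1)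
    (h : ∀ j ∈ L, ‖Y j - W j‖ ≤ δ) :
    ‖(L.map Y).prod - (L.map W).prod‖ ≤ L.length * δ := by
  have hprod : ∀ L : List α, (∀ j ∈ L, W j * (W j)ᴴ = 1) →
      (L.map W).prod * ((L.map W).prod)ᴴ = 1 := by
    intro L hL
    induction L with
    | nil => simp
    | cons a L ih =>
      have h1 := ih fun j hj => hL j (List.mem_cons_of_mem _ hj)
      rw [List.map_cons, List.prod_cons, Matrix.conjTranspose_mul, Matrix.mul_assoc,
        ← Matrix.mul_assoc _ _ (W a)ᴴ, h1, Matrix.one_mul, hL a List.mem_cons_self]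
  induction L with
  | nil => simp
  | cons a L ih =>
    have h1 := ih (fun j hj => hY j (List.mem_cons_of_mem _ hj))
      (fun j hj => hW j (List.mem_cons_of_mem _ hj)) (fun j hj => h j (List.mem_cons_of_mem _ hj))
    have e : ((a :: L).map Y).prod - ((a :: L).map W).prod =
        Y a * ((L.map Y).prod - (L.map W).prod) + (Y a - W a) * (L.map W).prod := by
      simp only [List.map_cons, List.prod_cons]; noncomm_ring
    rw [e]
    refine (norm_add_le _ _).trans ?_
    rw [frobenius_norm_isometry_mul (hY a List.mem_cons_self),
      frobenius_norm_mul_coisometry (hprod L fun j hj => hW j (List.mem_cons_of_mem _ hj))]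
    have := h a List.mem_cons_self
    rw [List.length_cons]
    push_cast
    linarith

/-- Involutions almost satisfying the relations of one equation `∏ x_j = (-1) ^ k` are near
involutions satisfying them exactly. -/
theorem exists_involutions_of_equation {α : Type*} [DecidableEq α] {κ : ℝ} (hκ0 : 0 ≤ κ)
    (W : α → Matrix ι ι ℂ) (hW : ∀ j, IsHermitianInvolution (W j)) (L : List α) (hL : L.Nodup)
    (hL0 : L ≠ []) (k : ℕ)
    (hκ : ∀ j ∈ L, ∀ k ∈ L, ‖W j * W k - W k * W j‖ ≤ κ)
    (hprod : ‖(L.map W).prod - (-1) ^ k‖ ≤ κ) :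
    ∃ Y : α → Matrix ι ι ℂ, (∀ j, IsHermitianInvolution (Y j)) ∧
      (∀ j ∈ L, ∀ k ∈ L, Y j * Y k = Y k * Y j) ∧ (L.map Y).prod = (-1) ^ k ∧
      ∀ j ∈ L, ‖Y j - W j‖ ≤ (1 + L.length * stabilityConst L.length) * κ := by
  obtain ⟨a, L, rfl⟩ := List.exists_cons_of_ne_nil hL0
  obtain ⟨haL, hL'⟩ := List.nodup_cons.1 hL
  obtain ⟨Y, hY, hYc, hYW⟩ := exists_commuting_involutions hκ0 W hW L hL' (fun j hj k hk =>
      hκ j (List.mem_cons_of_mem _ hj) k (List.mem_cons_of_mem _ hk))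
  have hσ : ((-1 : Matrix ι ι ℂ) ^ k) = 1 ∨ ((-1 : Matrix ι ι ℂ) ^ k) = -1 :=
    neg_one_pow_eq_or _ k
  set σ : Matrix ι ι ℂ := (-1) ^ k with hσdef
  have hσi : IsHermitianInvolution σ := by
    rcases hσ with h | h <;> rw [h]
    · exact .one
    · exact IsHermitianInvolution.one.neg
  have hσc : ∀ M, σ * M = M * σ := by rcases hσ with h | h <;> rw [h] <;> simp
  have hP := list_prod_mem_involution Y hY L hYc
  have hPc : ∀ j ∈ L, Y j * (L.map Y).prod = (L.map Y).prod * Y j := by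
    intro j hj
    refine (Commute.list_prod_right _ _ ?_).eq
    intro x hx
    obtain ⟨l, hl, rfl⟩ := List.mem_map.1 hx
    exact hYc j hj l hl
  set P := (L.map Y).prod with hPdef
  have hne : ∀ j ∈ L, j ≠ a := fun j hj h => haL (h ▸ hj)
  have hc0 := stabilityConst_nonneg L.length
  have hmap : L.map (Function.update Y a (σ * P)) = L.map Y :=
    List.map_congr_left fun j hj => Function.update_of_ne (hne j hj) _ _
  have hcom : ∀ j ∈ L, σ * P * Y j = Y j * (σ * P) := by
    intro j hj
    rw [Matrix.mul_assoc, ← hPc j hj, ← Matrix.mul_assoc, hσc, Matrix.mul_assoc]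
  -- After the other variables are made to commute, the equation is solved for the variable `a`;
  -- this is where `L` must be nonempty.
  refine ⟨Function.update Y a (σ * P), ?_, ?_, ?_, ?_⟩
  · intro j
    by_cases hj : j = a
    · subst hj; simpa using hσi.mul hP (hσc P)
    · simpa [hj] using hY j
  · intro j hj k hk
    rcases List.mem_cons.1 hj with rfl | hj' <;> rcases List.mem_cons.1 hk with rfl | hk'
    · rfl
    · rw [Function.update_self, Function.update_of_ne (hne k hk')]
      exact hcom k hk'
    · rw [Function.update_self, Function.update_of_ne (hne j hj')]
      exact (hcom j hj').symm
    · rw [Function.update_of_ne (hne k hk'), Function.update_of_ne (hne j hj')]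
      exact hYc j hj' k hk'
  · rw [List.map_cons, List.prod_cons, hmap, Function.update_self, Matrix.mul_assoc, hP.mul_self,
      mul_one]
  · intro j hj
    have hmono : stabilityConst L.length ≤ stabilityConst (a :: L).length :=
      stabilityConst_mono (by simp)
    set c := stabilityConst L.length
    set c' := stabilityConst (a :: L).length
    have hc' : 0 ≤ c' := hc0.trans hmono
    have hlen : ((a :: L).length : ℝ) = L.length + 1 := by simp
    rw [hlen]
    have hmul : c * κ ≤ c' * κ := by gcongr
    rcases List.mem_cons.1 hj with rfl | hj
    · rw [Function.update_self]
      have h1 : ‖P - (L.map W).prod‖ ≤ L.length * (c * κ) :=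
        norm_list_prod_sub_le Y W L (fun j _ => (hY j).conjTranspose_mul_self)
          (fun j _ => (hW j).mul_conjTranspose_self) hYW
      -- The first term is the drift of the product of the other variables, the second the original
      -- defect of the equation.
      have h2 : σ * P - W j =
          σ * (P - (L.map W).prod) + σ * (W j * (W j * (L.map W).prod - σ)) := by
        rw [mul_sub (W j), ← Matrix.mul_assoc (W j) (W j), (hW j).mul_self, ← hσc (W j),
          Matrix.one_mul, mul_sub, mul_sub, ← Matrix.mul_assoc σ σ, hσi.mul_self]
        noncomm_ring
      rw [h2]
      refine (norm_add_le _ _).trans ?_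
      rw [hσi.norm_mul, hσi.norm_mul, (hW j).norm_mul]
      rw [List.map_cons, List.prod_cons] at hprod
      have h3 : (L.length : ℝ) * (c * κ) ≤ L.length * (c' * κ) := by gcongr
      have h4 : 0 ≤ c' * κ := by positivity
      linarith
    · rw [Function.update_of_ne (hne j hj)]
      have h3 : 0 ≤ (L.length : ℝ) * (c' * κ) := by positivity
      have := hYW j hj
      linarith

/-- A unitary that is almost an involution is near an involution. -/
theorem exists_involution_near_unitary {u : Matrix ι ι ℂ} (hu : uᴴ * u = 1) {η : ℝ}
    (h : ‖u * u - 1‖ ≤ η) :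
    ∃ W : Matrix ι ι ℂ, IsHermitianInvolution W ∧ ‖W - u‖ ≤ η := by
  have hu' : u * uᴴ = 1 := mul_eq_one_comm.1 hu
  have half : ‖(1 / 2 : ℂ)‖ = 1 / 2 := by norm_num
  have quarter : ‖(1 / 4 : ℂ)‖ = 1 / 4 := by norm_num
  -- The involution is the sign of the Hermitian part of `u`. Both `H² - 1` and `H - u` are
  -- expressed through `u² - 1`, and each has norm at most `η / 2`.
  set H : Matrix ι ι ℂ := (1 / 2 : ℂ) • (u + uᴴ) with hH
  have hHh : H.IsHermitian := by
    rw [Matrix.IsHermitian, hH, Matrix.conjTranspose_smul, Matrix.conjTranspose_add,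
      Matrix.conjTranspose_conjTranspose, add_comm]
    simp
  obtain ⟨W, hW, -, hWH⟩ := exists_involution_near_hermitian hHh
  refine ⟨W, hW, ?_⟩
  have h1 : H * H - 1 = (1 / 4 : ℂ) • ((u * u - 1) + (u * u - 1)ᴴ) := by
    have : (u + uᴴ) * (u + uᴴ) = u * u + uᴴ * uᴴ + (2 : ℂ) • 1 := by
      rw [add_mul, mul_add, mul_add, hu, hu', two_smul]; abel
    rw [hH, Matrix.smul_mul, Matrix.mul_smul, this, Matrix.conjTranspose_sub,
      Matrix.conjTranspose_mul, Matrix.conjTranspose_one]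
    module
  have h2 : ‖H * H - 1‖ ≤ 1 / 2 * η := by
    rw [h1, norm_smul, quarter]
    have := norm_add_le (u * u - 1) (u * u - 1)ᴴ
    rw [Matrix.frobenius_norm_conjTranspose] at this
    linarith
  have h3 : H - u = (1 / 2 : ℂ) • (-(uᴴ * (u * u - 1))) := by
    rw [mul_sub, ← Matrix.mul_assoc, hu, Matrix.one_mul, hH, mul_one]
    module
  have h4 : ‖H - u‖ ≤ 1 / 2 * η := by
    rw [h3, norm_smul, half, norm_neg, frobenius_norm_isometry_mul (by simpa using hu')]
    linarith
  have h5 := norm_sub_le_norm_sub_add_norm_sub W H u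
  linarith

end Stability

/-! ### The inner product on a tensor product. -/

section TensorInner

variable {E F : Type*} [NormedAddCommGroup E] [InnerProductSpace ℂ E] [NormedAddCommGroup F]
  [InnerProductSpace ℂ F]

theorem tensor_inner_smul_right (c : ℂ) (x y : E ⊗[ℂ] F) :
    inner ℂ x (c • y) = c * inner ℂ x y := by
  exact inner_smul_right (𝕜 := ℂ) (E := E ⊗[ℂ] F) _ _ _

theorem tensor_inner_smul_left (c : ℂ) (x y : E ⊗[ℂ] F) :
    inner ℂ (c • x) y = starRingEnd ℂ c * inner ℂ x y := by
  exact inner_smul_left (𝕜 := ℂ) (E := E ⊗[ℂ] F) _ _ _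

theorem tensor_sum_inner {ι : Type*} (s : Finset ι) (f : ι → E ⊗[ℂ] F) (y : E ⊗[ℂ] F) :
    inner ℂ (∑ k ∈ s, f k) y = ∑ k ∈ s, inner ℂ (f k) y := by
  exact sum_inner (𝕜 := ℂ) (E := E ⊗[ℂ] F) _ _ _

theorem tensor_inner_sum {ι : Type*} (s : Finset ι) (f : ι → E ⊗[ℂ] F) (y : E ⊗[ℂ] F) :
    inner ℂ y (∑ k ∈ s, f k) = ∑ k ∈ s, inner ℂ y (f k) := by
  exact inner_sum (𝕜 := ℂ) (E := E ⊗[ℂ] F) _ _ _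

theorem tensor_inner_self (x : E ⊗[ℂ] F) : inner ℂ x x = ((‖x‖ ^ 2 : ℝ) : ℂ) := by
  rw [Complex.ofReal_pow]
  exact inner_self_eq_norm_sq_to_K (𝕜 := ℂ) (E := E ⊗[ℂ] F) _

end TensorInner

/-! ### The maximally entangled state and the trace. -/

section MaximallyEntangled

attribute [local instance] Matrix.frobeniusNormedAddCommGroup Matrix.frobeniusNormedSpace

/-- The maximally entangled state on `ℂ^d ⊗ ℂ^d`. -/
def maxEntangled (d : ℕ) : EuclideanSpace ℂ (Fin d) ⊗[ℂ] EuclideanSpace ℂ (Fin d) :=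
  ((√d)⁻¹ : ℂ) • ∑ k, EuclideanSpace.single k (1 : ℂ) ⊗ₜ[ℂ] EuclideanSpace.single k (1 : ℂ)

/-- The matrix coefficient between `e_k ⊗ e_k` and `e_l ⊗ e_l` is `Y k l * X k l`, and the double
sum is a trace against the transpose. Bob therefore plays transposed matrices. -/
theorem inner_maxEntangled {d : ℕ} (Y X : Matrix (Fin d) (Fin d) ℂ) :
    inner ℂ (maxEntangled d) (TensorProduct.mapL (Matrix.toEuclideanCLM (𝕜 := ℂ) Y)
      (Matrix.toEuclideanCLM (𝕜 := ℂ) X) (maxEntangled d)) = (Y * Xᵀ).trace / d := by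
  have key : ∀ (M : Matrix (Fin d) (Fin d) ℂ) (k l : Fin d),
      inner ℂ (EuclideanSpace.single k (1 : ℂ))
        (Matrix.toEuclideanCLM (𝕜 := ℂ) M (EuclideanSpace.single l (1 : ℂ))) = M k l := by
    intro M k l
    rw [EuclideanSpace.inner_single_left, Matrix.ofLp_toEuclideanCLM]
    simp
  have hd : ((√d : ℝ) : ℂ) * (√d : ℝ) = d := by
    rw [← Complex.ofReal_mul, Real.mul_self_sqrt (Nat.cast_nonneg d)]; simp
  simp only [maxEntangled, map_smul, map_sum, tensor_inner_smul_left,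
    tensor_inner_smul_right, tensor_sum_inner, tensor_inner_sum, TensorProduct.mapL_tmul,
    TensorProduct.inner_tmul, key, map_inv₀,
    Complex.conj_ofReal]
  rw [← Finset.mul_sum, ← mul_assoc, ← mul_inv, hd, Matrix.trace, div_eq_inv_mul, Finset.sum_comm]
  simp [Matrix.mul_apply]

theorem norm_maxEntangled {d : ℕ} (hd : 0 < d) : ‖maxEntangled d‖ = 1 := by
  have h := inner_maxEntangled (d := d) 1 1
  have h1 : TensorProduct.mapL (1 : EuclideanSpace ℂ (Fin d) →L[ℂ] EuclideanSpace ℂ (Fin d))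
      (1 : EuclideanSpace ℂ (Fin d) →L[ℂ] EuclideanSpace ℂ (Fin d)) = .id ℂ _ :=
    TensorProduct.mapL_id_id
  rw [map_one, h1, ContinuousLinearMap.id_apply, Matrix.transpose_one,
    mul_one, Matrix.trace_one, Fintype.card_fin, div_self (by exact_mod_cast hd.ne'),
    tensor_inner_self] at h
  have h2 : ‖maxEntangled d‖ ^ 2 = 1 := by exact_mod_cast h
  exact (pow_eq_one_iff_of_nonneg (norm_nonneg _) two_ne_zero).1 h2

theorem IsHermitianInvolution.isObservable {d : ℕ} {U : Matrix (Fin d) (Fin d) ℂ}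
    (h : IsHermitianInvolution U) :
    LinearSystem.IsObservable (Matrix.toEuclideanCLM (𝕜 := ℂ) U) := by
  refine ⟨?_, by rw [← map_mul, h.mul_self, map_one]⟩
  rw [IsSelfAdjoint, ← map_star, Matrix.star_eq_conjTranspose, h.isHermitian.eq]

/-- Expanding `(U - V)²` shows that the loss of correlation is quadratic in the distance, the source
of the exponent `1/2` in the upper bound. -/
theorem IsHermitianInvolution.re_trace_mul {d : ℕ} {U V : Matrix (Fin d) (Fin d) ℂ}
    (hU : IsHermitianInvolution U) (hV : IsHermitianInvolution V) :
    (U * V).trace.re = d - ‖U - V‖ ^ 2 / 2 := by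
  rw [frobenius_norm_sq_eq_trace, Matrix.conjTranspose_sub, hU.isHermitian.eq, hV.isHermitian.eq]
  have : (U - V) * (U - V) = U * U + V * V - U * V - V * U := by noncomm_ring
  rw [this, hU.mul_self, hV.mul_self, Matrix.trace_sub, Matrix.trace_sub, Matrix.trace_add,
    Matrix.trace_mul_comm V U]
  simp
  ring

/-- By the parallelogram law `‖U + 1‖² + ‖U - 1‖² = 4d`, so distance 2 is extremal and leaves
nothing for `U + 1`. -/
theorem eq_neg_one_of_two_le_normalizedFrobeniusNorm {d : ℕ} (hd : 0 < d)
    {U : Matrix (Fin d) (Fin d) ℂ} (hU : Uᴴ * U = 1) (h : 2 ≤ normalizedFrobeniusNorm (U - 1)) :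
    U = -1 := by
  have hd' : (0 : ℝ) < √d := Real.sqrt_pos.2 (by exact_mod_cast hd)
  rw [normalizedFrobeniusNorm_eq, le_div_iff₀ hd'] at h
  have h1 : ‖U‖ ^ 2 = d := by rw [frobenius_norm_sq_eq_trace, hU]; simp
  have h2 : ‖(1 : Matrix (Fin d) (Fin d) ℂ)‖ ^ 2 = d := by
    rw [frobenius_norm_one, Real.sq_sqrt (by positivity)]; simp
  have h3 : ‖U + 1‖ ^ 2 + ‖U - 1‖ ^ 2 = 2 * (‖U‖ ^ 2 + ‖(1 : Matrix (Fin d) (Fin d) ℂ)‖ ^ 2) := by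
    simp only [frobenius_norm_sq, ← Finset.sum_add_distrib, Finset.mul_sum]
    refine Finset.sum_congr rfl fun i _ => Finset.sum_congr rfl fun j _ => ?_
    have := parallelogram_law_with_norm ℂ (U i j) ((1 : Matrix (Fin d) (Fin d) ℂ) i j)
    simp only [Matrix.add_apply, Matrix.sub_apply]
    linarith
  have h4 : (2 * √d) ^ 2 ≤ ‖U - 1‖ ^ 2 := by gcongr
  rw [mul_pow, Real.sq_sqrt (by positivity)] at h4
  have h5 : ‖U + 1‖ ^ 2 ≤ 0 := by linarith
  have h6 : ‖U + 1‖ = 0 := by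
    have := sq_nonneg ‖U + 1‖
    exact pow_eq_zero_iff two_ne_zero |>.1 (le_antisymm h5 this)
  exact eq_neg_of_add_eq_zero_left (norm_eq_zero.1 h6)

end MaximallyEntangled

/-! ### From approximate representations to strategies. -/

namespace LinearSystem

variable {m n : ℕ} {A : Matrix (Fin m) (Fin n) (ZMod 2)} {b : Fin m → ZMod 2}

theorem mem_support {i : Fin m} {j : Fin n} : j ∈ support A i ↔ A i j ≠ 0 := by
  simp [support]

theorem nodup_support (A : Matrix (Fin m) (Fin n) (ZMod 2)) (i : Fin m) : (support A i).Nodup :=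
  (List.nodup_finRange n).filter _

theorem length_support_le (A : Matrix (Fin m) (Fin n) (ZMod 2)) (i : Fin m) :
    (support A i).length ≤ n :=
  (List.length_filter_le _ _).trans (List.length_finRange).le

/-- The constant in the construction of a strategy from an approximate representation. -/
def strategyConst (n : ℕ) : ℝ := (1 + n * stabilityConst n) * (n + 5)

theorem strategyConst_pos (n : ℕ) : 0 < strategyConst n := by
  have := stabilityConst_nonneg n
  rw [strategyConst]; positivity

section

attribute [local instance] Matrix.frobeniusNormedAddCommGroup Matrix.frobeniusNormedSpace

/-- Bob uses one involution `W j` per variable, near the image of `x_j`. Alice uses, equation by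
equation, an exact solution near the `W j`. An equation without variables cannot be repaired in this
way, hence `hb`. -/
theorem exists_strategy_of_isApproxRep (hb : ∀ i, support A i = [] → (b i).val = 0) {d : ℕ}
    (hd : 0 < d) {η : ℝ} {φ : FreeGroup (Option (Fin n)) →* Matrix.unitaryGroup (Fin d) ℂ}
    (hφ : IsApproxRep (solutionRelators A b) η φ)
    (hJ : 2 ≤ normalizedFrobeniusNorm ((φ (genJ n) : Matrix (Fin d) (Fin d) ℂ) - 1)) :
    ∃ S : Strategy A b (EuclideanSpace ℂ (Fin d)) (EuclideanSpace ℂ (Fin d)),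
      ∀ i j, A i j ≠ 0 → 1 - (strategyConst n * η) ^ 2 / 2 ≤ S.bias i j := by
  have hd' : (0 : ℝ) < √d := Real.sqrt_pos.2 (by exact_mod_cast hd)
  let ρ : FreeGroup (Option (Fin n)) →* Matrix (Fin d) (Fin d) ℂ :=
    (Submonoid.subtype _).comp φ
  have hρ1 : ∀ g, (ρ g)ᴴ * ρ g = 1 := fun g => Unitary.coe_star_mul_self (φ g)
  have hρ2 : ∀ g, ρ g * (ρ g)ᴴ = 1 := fun g => Unitary.coe_mul_star_self (φ g)
  have hrel : ∀ u v, u * v⁻¹ ∈ solutionRelators A b → ‖ρ u - ρ v‖ ≤ η * √d := by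
    intro u v h
    have h1 : ‖ρ (u * v⁻¹) - 1‖ ≤ η * √d := by
      have := hφ _ h
      rwa [normalizedFrobeniusNorm_eq, div_le_iff₀ hd'] at this
    have h2 : ρ u - ρ v = (ρ (u * v⁻¹) - 1) * ρ v := by
      rw [sub_mul, ← map_mul, inv_mul_cancel_right, one_mul]
    rwa [h2, frobenius_norm_mul_coisometry (hρ2 v)]
  have hρJ : ρ (genJ n) = -1 := eq_neg_one_of_two_le_normalizedFrobeniusNorm hd (hρ1 _) hJ
  set e : ℝ := η * √d with he
  have hsq : ∀ j : Fin n, ‖ρ (genX j) * ρ (genX j) - 1‖ ≤ e := by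
    intro j
    have := hrel (genX j ^ 2) 1 (by simpa [solutionRelators] using IsRelator.x_sq j)
    rwa [map_pow, map_one, pow_two] at this
  have he0 : 0 ≤ e := (norm_nonneg _).trans
    (hrel (genJ n ^ 2) 1 (by
      simpa [solutionRelators] using (IsRelator.J_sq : IsRelator A b _)))
  choose W hW hWu using fun j => exists_involution_near_unitary (hρ1 (genX j)) (hsq j)
  have hprodW : ∀ L : List (Fin n),
      ‖(L.map W).prod - (L.map fun j => ρ (genX j)).prod‖ ≤ L.length * e := fun L =>
    norm_list_prod_sub_le W (fun j => ρ (genX j)) L (fun j _ => (hW j).conjTranspose_mul_self)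
      (fun j _ => hρ2 _) (fun j _ => hWu j)
  have hn0 : (0 : ℝ) ≤ n := Nat.cast_nonneg n
  -- Two words of length 2 cost `2e` each and the relator costs `e`, which makes `5e`. The constant
  -- `n + 5` also covers the equation below, which costs `(n + 1)e`.
  have hcomm : ∀ i, ∀ j ∈ support A i, ∀ k ∈ support A i,
      ‖W j * W k - W k * W j‖ ≤ (n + 5) * e := by
    intro i j hj k hk
    have h1 := hprodW [j, k]
    have h2 := hprodW [k, j]
    have h3 := hrel (genX j * genX k) (genX k * genX j) (by
      have := (IsRelator.x_comm_x i j k (mem_support.1 hj) (mem_support.1 hk) : IsRelator A b _)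
      simpa [solutionRelators, mul_assoc] using this)
    simp only [List.map_cons, List.map_nil, List.prod_cons, List.prod_nil, mul_one,
      List.length_cons, List.length_nil, map_mul] at h1 h2 h3
    norm_num at h1 h2
    have h4 := norm_sub_le_norm_sub_add_norm_sub (W j * W k) (ρ (genX j) * ρ (genX k)) (W k * W j)
    have h5 := norm_sub_le_norm_sub_add_norm_sub (ρ (genX j) * ρ (genX k))
      (ρ (genX k) * ρ (genX j)) (W k * W j)
    rw [norm_sub_rev (ρ (genX k) * ρ (genX j)) (W k * W j)] at h5
    nlinarith [mul_nonneg hn0 he0]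
  have hprod : ∀ i, ‖((support A i).map W).prod - (-1) ^ (b i).val‖ ≤ (n + 5) * e := by
    intro i
    have h1 := hprodW (support A i)
    have h2 := hrel _ _ (IsRelator.equation i : IsRelator A b _)
    rw [map_list_prod, List.map_map, map_pow, hρJ] at h2
    have h3 := norm_sub_le_norm_sub_add_norm_sub ((support A i).map W).prod
      ((support A i).map fun j => ρ (genX j)).prod ((-1) ^ (b i).val)
    have h4 : ((support A i).length : ℝ) * e ≤ n * e := by
      have := length_support_le A i
      gcongr
    have h5 : ‖((support A i).map fun j => ρ (genX j)).prod - (-1) ^ (b i).val‖ ≤ e := h2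
    linarith
  have hY : ∀ i, ∃ Y : Fin n → Matrix (Fin d) (Fin d) ℂ, (∀ j, IsHermitianInvolution (Y j)) ∧
      (∀ j ∈ support A i, ∀ k ∈ support A i, Y j * Y k = Y k * Y j) ∧
      ((support A i).map Y).prod = (-1) ^ (b i).val ∧
      ∀ j ∈ support A i, ‖Y j - W j‖ ≤ strategyConst n * e := by
    intro i
    by_cases hs : support A i = []
    · exact ⟨W, hW, by simp [hs], by simp [hs, hb i hs], by simp [hs]⟩
    · obtain ⟨Y, h1, h2, h3, h4⟩ := exists_involutions_of_equation (κ := (n + 5) * e)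
        (by positivity) W hW (support A i) (nodup_support A i) hs (b i).val (hcomm i) (hprod i)
      refine ⟨Y, h1, h2, h3, fun j hj => (h4 j hj).trans ?_⟩
      have hl := length_support_le A i
      have := stabilityConst_mono hl
      have := stabilityConst_nonneg (support A i).length
      rw [strategyConst, mul_assoc]
      gcongr
  choose Y hYi hYc hYp hYW using hY
  refine ⟨{ ψ := maxEntangled d
            norm_ψ := norm_maxEntangled hd
            Y := fun i j => Matrix.toEuclideanCLM (𝕜 := ℂ) (Y i j)
            X := fun j => Matrix.toEuclideanCLM (𝕜 := ℂ) (W j)ᵀ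
            Y_observable := fun i j _ => (hYi i j).isObservable
            Y_prod := ?_
            Y_comm := ?_
            X_observable := fun j => (hW j).transpose.isObservable }, ?_⟩
  · intro i
    have := congrArg (Matrix.toEuclideanCLM (n := Fin d) (𝕜 := ℂ)) (hYp i)
    rw [map_list_prod, List.map_map, map_pow, map_neg, map_one] at this
    exact this
  · intro i j k hj hk
    rw [← map_mul, ← map_mul, hYc i j (mem_support.2 hj) k (mem_support.2 hk)]
  · intro i j hij
    simp only [Strategy.bias]
    rw [inner_maxEntangled, Matrix.transpose_transpose, ← Complex.ofReal_natCast,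
      Complex.div_ofReal_re, (hYi i j).re_trace_mul (hW j)]
    have h1 := hYW i j (mem_support.2 hij)
    have h2 : ‖Y i j - W j‖ ^ 2 ≤ (strategyConst n * e) ^ 2 := by gcongr
    have hd0 : (0 : ℝ) < d := by exact_mod_cast hd
    have h3 : (strategyConst n * e) ^ 2 = (strategyConst n * η) ^ 2 * d := by
      rw [he, ← mul_assoc, mul_pow, Real.sq_sqrt hd0.le]
    rw [le_div_iff₀ hd0]
    linarith

end

theorem edim_euclideanSpace (d : ℕ) : edim (EuclideanSpace ℂ (Fin d)) = d := by
  rw [edim, rank_eq_card_basis (EuclideanSpace.basisFun (Fin d) ℂ).toBasis]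
  simp

section Strategy

variable {HA HB : Type}
  [NormedAddCommGroup HA] [InnerProductSpace ℂ HA] [CompleteSpace HA]
  [NormedAddCommGroup HB] [InnerProductSpace ℂ HB] [CompleteSpace HB]

theorem Strategy.le_winProb (hm : 0 < m) (hn : 0 < n) (S : Strategy A b HA HB) {δ : ℝ}
    (hδ : 0 ≤ δ) (h : ∀ i j, A i j ≠ 0 → 1 - 2 * δ ≤ S.bias i j) : 1 - δ ≤ S.winProb := by
  have hmn : (0 : ℝ) < m * n := by positivity
  rw [Strategy.winProb, le_div_iff₀ hmn]
  have h1 : ∀ i j, 1 - δ ≤ S.winProbOn i j := by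
    intro i j
    rw [Strategy.winProbOn]
    split_ifs with hij
    · linarith [h i j hij]
    · linarith
  calc (1 - δ) * (m * n) = ∑ i : Fin m, ∑ j : Fin n, (1 - δ) := by simp; ring
    _ ≤ _ := Finset.sum_le_sum fun i _ => Finset.sum_le_sum fun j _ => h1 i j

/-- An empty product equal to `-1` would give `1 = -1` on `HA`, hence `HA = 0`, which leaves no unit
vector. -/
theorem Strategy.val_eq_zero_of_support_eq_nil (S : Strategy A b HA HB) (i : Fin m)
    (h : support A i = []) : (b i).val = 0 := by
  by_contra hne
  have hlt : (b i).val < 2 := ZMod.val_lt (b i)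
  have h1 : (b i).val = 1 := by omega
  have hp := S.Y_prod i
  rw [h, h1, List.map_nil, List.prod_nil, pow_one] at hp
  have hz : ∀ x : HA, x = 0 := by
    intro x
    have h2 : x = -x := congrArg (fun T : HA →L[ℂ] HA => T x) hp
    have h3 : (2 : ℂ) • x = 0 := by
      rw [two_smul]
      nth_rewrite 2 [h2]
      exact add_neg_cancel x
    exact (smul_eq_zero.1 h3).resolve_left two_ne_zero
  have hψ : S.ψ = 0 := by
    have : Subsingleton HA := ⟨fun x y => by rw [hz x, hz y]⟩
    exact Subsingleton.elim _ _
  have := S.norm_ψ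
  simp [hψ] at this

end Strategy

theorem entanglement_le_hyperlinearProfile (hm : 0 < m) (hn : 0 < n)
    (A : Matrix (Fin m) (Fin n) (ZMod 2)) (b : Fin m → ZMod 2) (hq : quantumValue A b = 1)
    {ε : ℝ} (hε : 0 < ε) :
    entanglement A b ε ≤ hyperlinearProfile (solutionRelators A b) {genJ n} 2
      ((strategyConst n)⁻¹ * √ε) := by
  have hb : ∀ i, support A i = [] → (b i).val = 0 := by
    -- The real supremum of the empty set is `0`, so quantum value 1 guarantees that some strategy
    -- exists.
    have hne : {p : ℝ | ∃ d : ℕ, IsAchievable A b d p}.Nonempty := by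
      by_contra h
      rw [Set.not_nonempty_iff_eq_empty] at h
      rw [quantumValue, h, Real.sSup_empty] at hq
      exact zero_ne_one hq
    obtain ⟨p, d, HA, HB, _, _, _, _, _, _, S, -⟩ := hne
    exact S.val_eq_zero_of_support_eq_nil
  refine le_sInf ?_
  rintro D ⟨d, hd, rfl, φ, hφ, hJ⟩
  obtain ⟨S, hS⟩ := exists_strategy_of_isApproxRep hb hd hφ (hJ _ (Finset.mem_singleton_self _))
  refine sInf_le ⟨d, rfl, S.winProb, ⟨_, _, _, _, _, _, _, _, S, ?_, rfl⟩, ?_⟩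
  · rw [edim_euclideanSpace, min_self]
  · rw [hq]
    -- With this tolerance the bias loss is `ε / 2`, well within the permitted `2ε`.
    refine S.le_winProb hm hn hε.le fun i j hij => le_trans ?_ (hS i j hij)
    rw [mul_inv_cancel_left₀ (strategyConst_pos n).ne', Real.sq_sqrt hε.le]
    linarith

end LinearSystem

/-! ### Choosing a superlevel set of the weights. -/

section Threshold

open MeasureTheory

/-- If weighted averages of a vertex cost `w` and of a boundary cost `c` are small, then some
superlevel set of the weights has small vertex and boundary cost. -/
theorem exists_superlevel_set {ι : Type*} [Fintype ι] [DecidableEq ι] (p : ι → ℝ)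
    (hp : ∀ k, 0 ≤ p k) (w : ι → ℝ) (c : ι → ι → ℝ) (η : ℝ)
    (h : ∑ k, p k * w k + ∑ k, ∑ l, max (p k - p l) 0 * c k l < η * ∑ k, p k) :
    ∃ S : Finset ι, S.Nonempty ∧
      ∑ k ∈ S, w k + ∑ k ∈ S, ∑ l ∈ Sᶜ, c k l < η * S.card := by
  -- Layer-cake: `p k` and `max (p k - p l) 0` are the integrals over `t` of the indicators of `0 ≤
  -- t < p k` and `p l ≤ t < p k`.
  let I : ℝ → ℝ → ℝ → ℝ := fun a b => (Set.Ico a b).indicator 1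
  have hI : ∀ a b, Integrable (I a b) := fun a b =>
    (integrable_indicator_iff measurableSet_Ico).2 (integrableOn_const (by simp))
  have hIint : ∀ a b, ∫ t, I a b t = max (b - a) 0 := by
    intro a b
    rw [integral_indicator_one measurableSet_Ico, Real.volume_real_Ico]
  -- For `t ≥ 0` this is the total cost of `{k | t < p k}` minus `η` times its cardinality. Its
  -- integral is negative, so it is negative at some `t`.
  let g : ℝ → ℝ := fun t => ∑ k, (w k - η) * I 0 (p k) t + ∑ k, ∑ l, c k l * I (p l) (p k) t
  have hg : ∫ t, g t < 0 := by
    have h1 : ∫ t, g t = ∑ k, (w k - η) * p k + ∑ k, ∑ l, c k l * max (p k - p l) 0 := by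
      rw [integral_add]
      · rw [integral_finsetSum _ fun k _ => (hI _ _).const_mul _,
          integral_finsetSum _ fun k _ => integrable_finsetSum _ fun l _ => (hI _ _).const_mul _]
        congr 1
        · refine Finset.sum_congr rfl fun k _ => ?_
          rw [integral_const_mul, hIint, sub_zero, max_eq_left (hp k)]
        · refine Finset.sum_congr rfl fun k _ => ?_
          rw [integral_finsetSum _ fun l _ => (hI _ _).const_mul _]
          refine Finset.sum_congr rfl fun l _ => ?_
          rw [integral_const_mul, hIint]
      · exact integrable_finsetSum _ fun k _ => (hI _ _).const_mul _
      · exact integrable_finsetSum _ fun k _ => integrable_finsetSum _ fun l _ =>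
          (hI _ _).const_mul _
    rw [h1]
    simp only [sub_mul, Finset.sum_sub_distrib, ← Finset.mul_sum, mul_comm (w _), mul_comm (c _ _)]
    linarith
  obtain ⟨t, ht⟩ : ∃ t, g t < 0 := by
    by_contra hcon
    push Not at hcon
    exact absurd (integral_nonneg hcon) (not_le.2 hg)
  -- For `t < 0` all the indicators vanish, as the weights are nonnegative.
  have ht0 : 0 ≤ t := by
    by_contra hneg
    push Not at hneg
    have hz : ∀ a b, 0 ≤ a → I a b t = 0 := fun a b ha =>
      Set.indicator_of_notMem (fun hm => absurd (ha.trans hm.1) (not_le.2 hneg)) _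
    have : g t = 0 := by
      simp only [g, hz 0 _ le_rfl, hz _ _ (hp _), mul_zero, Finset.sum_const_zero, add_zero]
    exact ht.ne this
  let S : Finset ι := Finset.univ.filter fun k => t < p k
  have hS1 : ∀ k, I 0 (p k) t = if k ∈ S then 1 else 0 := by
    intro k
    simp [I, S, Set.indicator_apply, ht0]
  have hS2 : ∀ k l, I (p l) (p k) t = if k ∈ S then (if l ∈ Sᶜ then 1 else 0) else 0 := by
    intro k l
    by_cases h1 : t < p k <;> by_cases h2 : t < p l <;>
      simp [I, S, h1, h2, not_lt.1]
  have hgS : g t = ∑ k ∈ S, w k - η * S.card + ∑ k ∈ S, ∑ l ∈ Sᶜ, c k l := by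
    simp only [g, hS1, hS2, mul_ite, mul_one, mul_zero]
    congr 1
    · rw [Finset.sum_ite_mem, Finset.univ_inter, Finset.sum_sub_distrib, Finset.sum_const,
        nsmul_eq_mul, mul_comm η]
    · rw [← Finset.sum_filter_add_sum_filter_not Finset.univ (· ∈ S)]
      rw [Finset.sum_eq_zero (s := Finset.univ.filter fun k => ¬ k ∈ S), add_zero,
        Finset.filter_mem_eq_inter, Finset.univ_inter]
      · refine Finset.sum_congr rfl fun k hk => ?_
        simp only [hk, if_true]
        rw [Finset.sum_ite_mem, Finset.univ_inter]
      · intro k hk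
        simp [(Finset.mem_filter.1 hk).2]
  refine ⟨S, ?_, by linarith⟩
  by_contra hempty
  rw [Finset.not_nonempty_iff_eq_empty] at hempty
  rw [hgS, hempty] at ht
  simp at ht

end Threshold

/-! ### Compressing involutions to an almost invariant coordinate subspace. -/

section Compression

attribute [local instance] Matrix.frobeniusNormedAddCommGroup Matrix.frobeniusNormedSpace

variable {ι : Type*} [Fintype ι] [DecidableEq ι]

/-- The inclusion of the span of the basis vectors in `S`. -/
def coordInclusion (S : Finset ι) : Matrix ι (Fin S.card) ℂ :=
  (1 : Matrix ι ι ℂ).submatrix id (fun a => (S.equivFin.symm a : ι))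

theorem mul_coordInclusion (S : Finset ι) (M : Matrix ι ι ℂ) :
    M * coordInclusion S = M.submatrix id (fun a => (S.equivFin.symm a : ι)) := by
  ext a b
  simp [coordInclusion, Matrix.mul_apply, Matrix.one_apply]

theorem conjTranspose_coordInclusion_mul {κ : Type*} (S : Finset ι) (M : Matrix ι κ ℂ) :
    (coordInclusion S)ᴴ * M = M.submatrix (fun a => (S.equivFin.symm a : ι)) id := by
  ext a b
  simp [coordInclusion, Matrix.mul_apply, Matrix.one_apply]

theorem coordInclusion_isometry (S : Finset ι) :
    (coordInclusion S)ᴴ * coordInclusion S = 1 := by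
  rw [conjTranspose_coordInclusion_mul, coordInclusion]
  ext a b
  simp [Matrix.one_apply]

theorem sum_equivFin {κ : Type*} (S : Finset κ) (f : κ → ℝ) :
    ∑ a, f (S.equivFin.symm a) = ∑ k ∈ S, f k := by
  rw [Equiv.sum_comp S.equivFin.symm (fun k : S => f k), Finset.sum_coe_sort]

theorem norm_mul_coordInclusion_sq (S : Finset ι) (M : Matrix ι ι ℂ) :
    ‖M * coordInclusion S‖ ^ 2 = ∑ k ∈ S, ∑ i, ‖M i k‖ ^ 2 := by
  rw [frobenius_norm_sq, Finset.sum_comm, mul_coordInclusion]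
  exact sum_equivFin S fun k => ∑ i, ‖M i k‖ ^ 2

theorem norm_conjTranspose_coordInclusion_mul_le {κ : Type*} [Fintype κ] (S : Finset ι)
    (M : Matrix ι κ ℂ) : ‖(coordInclusion S)ᴴ * M‖ ≤ ‖M‖ := by
  refine le_of_sq_le_sq ?_ (norm_nonneg _)
  rw [frobenius_norm_sq, frobenius_norm_sq, conjTranspose_coordInclusion_mul]
  refine (sum_equivFin S fun i => ∑ j, ‖M i j‖ ^ 2).trans_le ?_
  exact Finset.sum_le_sum_of_subset_of_nonneg (Finset.subset_univ S) fun i _ _ => by positivity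

/-- An involution almost preserving a coordinate subspace is near one of that subspace. -/
theorem exists_compressed_involution {Z : Matrix ι ι ℂ} (hZ : IsHermitianInvolution Z)
    (S : Finset ι) {θ : ℝ} (hθ : ∑ k ∈ S, ∑ l ∈ Sᶜ, ‖Z l k‖ ^ 2 ≤ θ ^ 2) (hθ0 : 0 ≤ θ) :
    ∃ U : Matrix (Fin S.card) (Fin S.card) ℂ, IsHermitianInvolution U ∧
      ‖Z * coordInclusion S - coordInclusion S * U‖ ≤ 2 * θ := by
  set V := coordInclusion S with hV
  have hVV : Vᴴ * V = 1 := coordInclusion_isometry S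
  set B := Vᴴ * (Z * V) with hB
  have hBh : B.IsHermitian := by
    rw [Matrix.IsHermitian, hB, Matrix.conjTranspose_mul, Matrix.conjTranspose_mul,
      Matrix.conjTranspose_conjTranspose, hZ.isHermitian.eq, Matrix.mul_assoc]
  obtain ⟨U, hU, -, hUB⟩ := exists_involution_near_hermitian hBh
  refine ⟨U, hU, ?_⟩
  set D := Z * V - V * B with hD
  have hDθ : ‖D‖ ≤ θ := by
    refine le_of_sq_le_sq (le_of_eq_of_le ?_ hθ) hθ0
    rw [frobenius_norm_sq, Finset.sum_comm, ← sum_equivFin S fun k => ∑ l ∈ Sᶜ, ‖Z l k‖ ^ 2]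
    refine Finset.sum_congr rfl fun a _ => ?_
    -- `V * B` is the part of `Z * V` with rows in `S`, so `D` consists of the entries of `Z` that
    -- leave `S`.
    have hent : ∀ i, D i a = if i ∈ Sᶜ then Z i (S.equivFin.symm a) else 0 := by
      intro i
      rw [hD, Matrix.sub_apply, hB, hV, mul_coordInclusion, conjTranspose_coordInclusion_mul]
      by_cases hi : i ∈ S
      · have : (coordInclusion S * ((Z.submatrix id fun a => (S.equivFin.symm a : ι)).submatrix
            (fun a => (S.equivFin.symm a : ι)) id)) i a = Z i (S.equivFin.symm a) := by
          rw [Matrix.mul_apply, Finset.sum_eq_single (S.equivFin ⟨i, hi⟩)]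
          · simp [coordInclusion, Matrix.one_apply]
          · intro c _ hc
            have : (i : ι) ≠ S.equivFin.symm c := by
              intro h
              apply hc
              rw [← Equiv.symm_apply_eq, Subtype.ext_iff]
              exact h.symm
            simp [coordInclusion, this]
          · simp
        rw [this]
        simp [hi]
      · rw [Matrix.mul_apply, Finset.sum_eq_zero]
        · simp [hi]
        · intro c _
          have : (i : ι) ≠ S.equivFin.symm c := fun h => hi (h ▸ (S.equivFin.symm c).2)
          simp [coordInclusion, this]
    simp only [hent]
    rw [← Finset.sum_subset (Finset.subset_univ Sᶜ)]
    · exact Finset.sum_congr rfl fun i hi => by rw [if_pos hi]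
    · intro i _ hi
      rw [if_neg hi]; simp
  -- As `Z² = 1`, the failure of the compression to be an involution is governed by the leakage `D`;
  -- the sign of `B` then adds at most another `θ`.
  have h1 : B * B - 1 = -(Vᴴ * (Z * D)) := by
    rw [hD, Matrix.mul_sub, Matrix.mul_sub, ← Matrix.mul_assoc Z Z, hZ.mul_self, Matrix.one_mul,
      hVV, neg_sub]
    congr 1
    conv_lhs => rw [hB]
    rw [← hB]
    simp only [Matrix.mul_assoc, hB]
  have h2 : ‖B * B - 1‖ ≤ θ := by
    rw [h1, norm_neg]
    exact (norm_conjTranspose_coordInclusion_mul_le S _).trans ((hZ.norm_mul D).trans_le hDθ)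
  have h3 : Z * V - V * U = D - V * (U - B) := by rw [hD, Matrix.mul_sub]; abel
  rw [h3]
  have h4 := norm_sub_le D (V * (U - B))
  rw [frobenius_norm_isometry_mul hVV] at h4
  linarith

theorem IsHermitianInvolution.list_prod_isometry {α : Type*} {U : α → Matrix ι ι ℂ}
    (hU : ∀ j, IsHermitianInvolution (U j)) (L : List α) :
    (L.map U).prod * ((L.map U).prod)ᴴ = 1 := by
  induction L with
  | nil => simp
  | cons a L ih =>
    rw [List.map_cons, List.prod_cons, Matrix.conjTranspose_mul, Matrix.mul_assoc,
      ← Matrix.mul_assoc _ _ (U a)ᴴ, ih, Matrix.one_mul, (hU a).mul_conjTranspose_self]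

/-- The letters pass through `V` one at a time, each costing `θ`, since the remaining factors
preserve the norm. -/
theorem norm_list_prod_intertwine_le {κ α : Type*} [Fintype κ] [DecidableEq κ] {θ : ℝ}
    {Z : α → Matrix ι ι ℂ} (hZ : ∀ j, IsHermitianInvolution (Z j)) {U : α → Matrix κ κ ℂ}
    (hU : ∀ j, IsHermitianInvolution (U j)) (V : Matrix ι κ ℂ)
    (h : ∀ j, ‖Z j * V - V * U j‖ ≤ θ) (L : List α) :
    ‖(L.map Z).prod * V - V * (L.map U).prod‖ ≤ L.length * θ := by
  induction L with
  | nil => simp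
  | cons a L ih =>
    have e : ((a :: L).map Z).prod * V - V * ((a :: L).map U).prod =
        Z a * ((L.map Z).prod * V - V * (L.map U).prod) + (Z a * V - V * U a) * (L.map U).prod := by
      simp only [List.map_cons, List.prod_cons, Matrix.mul_sub, Matrix.sub_mul, Matrix.mul_assoc]
      abel
    rw [e]
    refine (norm_add_le _ _).trans ?_
    rw [(hZ a).norm_mul, frobenius_norm_mul_coisometry
      (IsHermitianInvolution.list_prod_isometry hU L), List.length_cons]
    push_cast
    linarith [h a]

/-- Involutions satisfying relations `∏ x_j = (-1) ^ k` approximately, on average over a state with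
weights `p` that they almost preserve, can be rounded to involutions satisfying the relations
approximately in the normalized Frobenius norm. -/
theorem exists_rounded_involutions {α : Type*} [Fintype α] {Z : α → Matrix ι ι ℂ}
    (hZ : ∀ j, IsHermitianInvolution (Z j)) (p : ι → ℝ) (hp : ∀ k, 0 ≤ p k) (hp1 : ∑ k, p k = 1)
    (T : Finset (List α × ℕ)) {N : ℕ} (hN : ∀ q ∈ T, q.1.length ≤ N) {τ : ℝ} (hτ : 0 < τ)
    (h1 : ∀ j, ∑ k, ∑ l, max (p k - p l) 0 * ‖Z j l k‖ ^ 2 ≤ τ)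
    (h2 : ∀ q ∈ T, ∑ k, p k * ∑ i, ‖((q.1.map Z).prod - (-1) ^ q.2) i k‖ ^ 2 ≤ τ) :
    ∃ r : ℕ, 0 < r ∧ r ≤ Fintype.card ι ∧ ∃ U : α → Matrix (Fin r) (Fin r) ℂ,
      (∀ j, IsHermitianInvolution (U j)) ∧ ∀ q ∈ T,
        normalizedFrobeniusNorm ((q.1.map U).prod - (-1) ^ q.2) ≤
          (2 * N + 1) * √((Fintype.card α + T.card + 1) * τ) := by
  -- One cost `τ` for each generator (leakage) and each relation (defect), and one more to make the
  -- inequality strict.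
  set M : ℝ := Fintype.card α + T.card + 1 with hM
  have hM0 : 0 < M := by positivity
  let w : ι → ℝ := fun k => ∑ q ∈ T, ∑ i, ‖((q.1.map Z).prod - (-1) ^ q.2) i k‖ ^ 2
  let c : ι → ι → ℝ := fun k l => ∑ j, ‖Z j l k‖ ^ 2
  obtain ⟨S, hS, hcost⟩ := exists_superlevel_set p hp w c (M * τ) (by
    have e1 : ∑ k, p k * w k ≤ T.card * τ := by
      simp only [w, Finset.mul_sum (s := T)]
      rw [Finset.sum_comm]
      calc _ ≤ ∑ q ∈ T, τ := Finset.sum_le_sum fun q hq => h2 q hq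
        _ = _ := by simp
    have e2 : ∑ k, ∑ l, max (p k - p l) 0 * c k l ≤ Fintype.card α * τ := by
      simp only [c, Finset.mul_sum (s := (Finset.univ : Finset α))]
      have : ∀ k, ∑ l, ∑ j, max (p k - p l) 0 * ‖Z j l k‖ ^ 2 =
          ∑ j, ∑ l, max (p k - p l) 0 * ‖Z j l k‖ ^ 2 := fun k => Finset.sum_comm
      simp only [this]
      rw [Finset.sum_comm]
      calc _ ≤ ∑ j : α, τ := Finset.sum_le_sum fun j _ => h1 j
        _ = _ := by simp
    rw [hp1, hM]
    linarith)
  have hr0 : 0 < S.card := hS.card_pos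
  have hr : (0 : ℝ) < S.card := by exact_mod_cast hr0
  set θ : ℝ := √(M * τ * S.card) with hθ
  have hθ2 : θ ^ 2 = M * τ * S.card := Real.sq_sqrt (by positivity)
  have hw0 : 0 ≤ ∑ k ∈ S, w k := by positivity
  have hc0 : 0 ≤ ∑ k ∈ S, ∑ l ∈ Sᶜ, c k l := by positivity
  -- All costs are nonnegative, so each is bounded by the total.
  have hbd : ∀ j, ∑ k ∈ S, ∑ l ∈ Sᶜ, ‖Z j l k‖ ^ 2 ≤ θ ^ 2 := by
    intro j
    have : ∑ k ∈ S, ∑ l ∈ Sᶜ, ‖Z j l k‖ ^ 2 ≤ ∑ k ∈ S, ∑ l ∈ Sᶜ, c k l := by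
      refine Finset.sum_le_sum fun k _ => Finset.sum_le_sum fun l _ => ?_
      exact Finset.single_le_sum (f := fun j => ‖Z j l k‖ ^ 2) (fun _ _ => by positivity)
        (Finset.mem_univ j)
    linarith
  choose U hU hUV using fun j =>
    exists_compressed_involution (hZ j) S (hbd j) (Real.sqrt_nonneg _)
  refine ⟨S.card, hr0, Finset.card_le_univ S, U, hU, fun q hq => ?_⟩
  set V := coordInclusion S with hV
  have hq1 : ‖((q.1.map Z).prod - (-1) ^ q.2) * V‖ ≤ θ := by
    refine le_of_sq_le_sq ?_ (Real.sqrt_nonneg _)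
    rw [hV, norm_mul_coordInclusion_sq]
    have : ∑ k ∈ S, ∑ i, ‖((q.1.map Z).prod - (-1) ^ q.2) i k‖ ^ 2 ≤ ∑ k ∈ S, w k := by
      refine Finset.sum_le_sum fun k _ => ?_
      exact Finset.single_le_sum
        (f := fun q : List α × ℕ => ∑ i, ‖((q.1.map Z).prod - (-1) ^ q.2) i k‖ ^ 2)
        (fun _ _ => by positivity) hq
    linarith
  have hq2 := norm_list_prod_intertwine_le hZ hU V hUV q.1
  have hσ : V * (-1 : Matrix (Fin S.card) (Fin S.card) ℂ) ^ q.2 =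
      (-1 : Matrix ι ι ℂ) ^ q.2 * V := by
    rcases neg_one_pow_eq_or (Matrix (Fin S.card) (Fin S.card) ℂ) q.2 with h | h <;>
      rcases Nat.even_or_odd q.2 with h' | h' <;> simp [h'.neg_one_pow]
  -- The defect on the subspace contributes `θ`, and passing at most `N` letters through `V`
  -- contributes `2θ` each.
  have hq3 : ‖(q.1.map U).prod - (-1) ^ q.2‖ ≤ (2 * N + 1) * θ := by
    rw [← frobenius_norm_isometry_mul (coordInclusion_isometry S), ← hV]
    have e : V * ((q.1.map U).prod - (-1) ^ q.2) = ((q.1.map Z).prod - (-1) ^ q.2) * V -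
        ((q.1.map Z).prod * V - V * (q.1.map U).prod) := by
      rw [Matrix.mul_sub, hσ, Matrix.sub_mul]; abel
    rw [e]
    refine (norm_sub_le _ _).trans ?_
    have hl : (q.1.length : ℝ) * (2 * θ) ≤ N * (2 * θ) := by
      have := hN q hq
      have : (0 : ℝ) ≤ θ := Real.sqrt_nonneg _
      gcongr
    linarith
  rw [normalizedFrobeniusNorm_eq, div_le_iff₀ (Real.sqrt_pos.2 hr), mul_assoc,
    ← Real.sqrt_mul (by positivity)]
  exact hq3

end Compression

theorem hyperlinearProfile_anti {S : Type} (R : Set (FreeGroup S)) (T : Finset (FreeGroup S))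
    (δ : ℝ) {ε ε' : ℝ} (h : ε ≤ ε') :
    hyperlinearProfile R T δ ε' ≤ hyperlinearProfile R T δ ε :=
  sInf_le_sInf fun _ ⟨d, hd, hD, φ, hφ, hT⟩ =>
    ⟨d, hd, hD, φ, fun r hr => (hφ r hr).trans h, hT⟩

/-! ### From approximate solutions in involutions to approximate representations. -/

namespace LinearSystem

variable {m n : ℕ} {A : Matrix (Fin m) (Fin n) (ZMod 2)} {b : Fin m → ZMod 2}

/-- The relations `∏ x_j = (-1) ^ k` of the solution group (with `J = -1`) other than `x_j ^ 2 = 1`,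
as pairs of a word in the `x_j` and an exponent `k`. -/
def relatorWords (A : Matrix (Fin m) (Fin n) (ZMod 2)) (b : Fin m → ZMod 2) :
    Finset (List (Fin n) × ℕ) :=
  Finset.univ.image (fun i => (support A i, (b i).val)) ∪
    ((Finset.univ : Finset (Fin m × Fin n × Fin n)).filter
      fun q => A q.1 q.2.1 ≠ 0 ∧ A q.1 q.2.2 ≠ 0).image
      -- Involutions are their own inverses, so this word is the commutator.
      fun q => ([q.2.1, q.2.2, q.2.1, q.2.2], 0)

theorem equation_mem_relatorWords (i : Fin m) :
    (support A i, (b i).val) ∈ relatorWords A b :=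
  Finset.mem_union_left _ (Finset.mem_image_of_mem _ (Finset.mem_univ i))

theorem commutator_mem_relatorWords {i : Fin m} {j k : Fin n} (hj : A i j ≠ 0) (hk : A i k ≠ 0) :
    ([j, k, j, k], 0) ∈ relatorWords A b :=
  Finset.mem_union_right _ (Finset.mem_image.2
    ⟨(i, j, k), Finset.mem_filter.2 ⟨Finset.mem_univ _, hj, hk⟩, rfl⟩)

theorem of_mem_relatorWords {q : List (Fin n) × ℕ} (hq : q ∈ relatorWords A b) :
    (∃ i, q = (support A i, (b i).val)) ∨
      ∃ i j k, A i j ≠ 0 ∧ A i k ≠ 0 ∧ q = ([j, k, j, k], 0) := by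
  rcases Finset.mem_union.1 hq with h | h
  · obtain ⟨i, -, rfl⟩ := Finset.mem_image.1 h
    exact Or.inl ⟨i, rfl⟩
  · obtain ⟨⟨i, j, k⟩, hf, rfl⟩ := Finset.mem_image.1 h
    exact Or.inr ⟨i, j, k, (Finset.mem_filter.1 hf).2.1, (Finset.mem_filter.1 hf).2.2, rfl⟩

attribute [local instance] Matrix.frobeniusNormedAddCommGroup Matrix.frobeniusNormedSpace

/-- Involutions approximately satisfying the relations give an approximate representation of the
solution group with `J ↦ -1`. -/
theorem hyperlinearProfile_le_of_involutions {r : ℕ} (hr : 0 < r) {η : ℝ} (hη : 0 ≤ η)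
    {U : Fin n → Matrix (Fin r) (Fin r) ℂ} (hU : ∀ j, IsHermitianInvolution (U j))
    (h : ∀ q ∈ relatorWords A b, normalizedFrobeniusNorm ((q.1.map U).prod - (-1) ^ q.2) ≤ η) :
    hyperlinearProfile (solutionRelators A b) {genJ n} 2 η ≤ r := by
  have hmem : ∀ {V : Matrix (Fin r) (Fin r) ℂ}, IsHermitianInvolution V →
      V ∈ Matrix.unitaryGroup (Fin r) ℂ := fun hV =>
    Matrix.mem_unitaryGroup_iff.2 hV.mul_conjTranspose_self
  let φ : FreeGroup (Option (Fin n)) →* Matrix.unitaryGroup (Fin r) ℂ :=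
    FreeGroup.lift fun o => o.elim ⟨-1, hmem IsHermitianInvolution.one.neg⟩
      fun j => ⟨U j, hmem (hU j)⟩
  let ρ : FreeGroup (Option (Fin n)) →* Matrix (Fin r) (Fin r) ℂ := (Submonoid.subtype _).comp φ
  have hρX : ∀ j, ρ (genX j) = U j := fun j => by simp [ρ, φ, genX]
  have hρJ : ρ (genJ n) = -1 := by simp [ρ, φ, genJ]
  have hρinv : ∀ g, ρ g⁻¹ = (ρ g)ᴴ := fun g => by
    simp [ρ, map_inv, Matrix.star_eq_conjTranspose]
  have hρXi : ∀ j, ρ (genX j)⁻¹ = U j := fun j => by rw [hρinv, hρX, (hU j).isHermitian.eq]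
  have hρJi : ρ (genJ n)⁻¹ = -1 := by rw [hρinv, hρJ]; simp
  have hzero : normalizedFrobeniusNorm ((1 : Matrix (Fin r) (Fin r) ℂ) - 1) ≤ η := by
    rw [normalizedFrobeniusNorm_eq, sub_self, norm_zero, zero_div]; exact hη
  refine sInf_le ⟨r, hr, rfl, φ, ?_, ?_⟩
  · intro g hg
    change normalizedFrobeniusNorm (ρ g - 1) ≤ η
    -- With `J ↦ -1` and involutions, the relators `J_sq`, `x_comm_J` and `x_sq` hold exactly; only
    -- equations and commutators carry an error.
    cases hg with
    | J_sq => rw [map_pow, hρJ]; simpa using hzero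
    | x_comm_J j =>
      simp only [map_mul, hρX, hρJ, hρXi, hρJi]
      simpa [(hU j).mul_self] using hzero
    | x_sq j => rw [map_pow, hρX, pow_two, (hU j).mul_self]; exact hzero
    | equation i =>
      have h1 := h _ (equation_mem_relatorWords (A := A) (b := b) i)
      rw [map_mul, map_list_prod, List.map_map, hρinv, map_pow, hρJ]
      have hL : (support A i).map (ρ ∘ genX) = (support A i).map U :=
        List.map_congr_left fun j _ => hρX j
      rw [hL]
      rw [normalizedFrobeniusNorm_eq] at h1 ⊢
      refine le_of_eq_of_le ?_ h1
      congr 1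
      rcases Nat.even_or_odd (b i).val with h' | h'
      · simp [h'.neg_one_pow]
      · simp only [h'.neg_one_pow]
        rw [Matrix.conjTranspose_neg, Matrix.conjTranspose_one, mul_neg, mul_one, ← norm_neg]
        congr 1
        abel
    | x_comm_x i j k hj hk =>
      have h1 := h _ (commutator_mem_relatorWords hj hk)
      simp only [map_mul, hρX, hρXi]
      simpa [mul_assoc] using h1
  · intro w hw
    rw [Finset.mem_singleton.1 hw]
    change 2 ≤ normalizedFrobeniusNorm (ρ (genJ n) - 1)
    have e : (-1 : Matrix (Fin r) (Fin r) ℂ) - 1 = (-2 : ℂ) • 1 := by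
      rw [neg_smul, two_smul]; abel
    have hr' : (0 : ℝ) < √r := Real.sqrt_pos.2 (by exact_mod_cast hr)
    rw [hρJ, normalizedFrobeniusNorm_eq, e, norm_smul, frobenius_norm_one, Fintype.card_fin,
      mul_div_assoc, div_self hr'.ne']
    simp

end LinearSystem

/-! ### Almost maximal overlap forces concentration on nearby weights. -/

section Overlap

/-- If the overlap `∑ s k * s l * α k l * β k l` is almost maximal then `α` is almost supported on
pairs with nearby weights. -/
theorem sum_sub_sq_mul_sq_le {ι : Type*} [Fintype ι] {s : ι → ℝ} (hs1 : ∑ k, s k ^ 2 = 1)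
    (hs : ∀ k, 0 ≤ s k) {α β : ι → ι → ℝ} (hα : ∀ k l, α k l = α l k) (hβ : ∀ k l, β k l = β l k)
    (hα1 : ∀ k, ∑ l, α k l ^ 2 = 1) (hβ1 : ∀ k, ∑ l, β k l ^ 2 ≤ 1) {δ : ℝ}
    (h : 1 - δ ≤ ∑ k, ∑ l, s k * s l * (α k l * β k l)) :
    ∑ k, ∑ l, (s k - s l) ^ 2 * α k l ^ 2 ≤ 4 * δ ∧
      ∑ k, ∑ l, (s k + s l) ^ 2 * α k l ^ 2 ≤ 4 := by
  have a1 : ∑ k, ∑ l, s k ^ 2 * α k l ^ 2 = 1 := by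
    simp only [← Finset.mul_sum, hα1, mul_one, hs1]
  have a2 : ∑ k, ∑ l, s l ^ 2 * α k l ^ 2 = 1 := by
    rw [Finset.sum_comm, ← a1]
    exact Finset.sum_congr rfl fun k _ => Finset.sum_congr rfl fun l _ => by rw [hα]
  have b1 : ∑ k, ∑ l, s k ^ 2 * β k l ^ 2 ≤ 1 := by
    rw [← hs1]
    refine Finset.sum_le_sum fun k _ => ?_
    rw [← Finset.mul_sum]
    exact mul_le_of_le_one_right (sq_nonneg _) (hβ1 k)
  have b2 : ∑ k, ∑ l, s l ^ 2 * β k l ^ 2 ≤ 1 := by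
    refine le_of_eq_of_le ?_ b1
    rw [Finset.sum_comm]
    exact Finset.sum_congr rfl fun k _ => Finset.sum_congr rfl fun l _ => by rw [hβ]
  constructor
  · have key : ∑ k, ∑ l, (s k - s l) ^ 2 * α k l ^ 2 ≤ ∑ k, ∑ l, (s k ^ 2 * α k l ^ 2 +
        s l ^ 2 * α k l ^ 2 + s k ^ 2 * β k l ^ 2 + s l ^ 2 * β k l ^ 2 -
        4 * (s k * s l * (α k l * β k l))) := by
      refine Finset.sum_le_sum fun k _ => Finset.sum_le_sum fun l _ => ?_
      -- The difference of the two sides is `2 s_k s_l (α - β)² + (s_k - s_l)² β²`. The right side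
      -- then sums to at most `4 - 4(1 - δ)`.
      have h1 := mul_nonneg (mul_nonneg (hs k) (hs l)) (sq_nonneg (α k l - β k l))
      have h2 := mul_nonneg (sq_nonneg (s k - s l)) (sq_nonneg (β k l))
      linarith
    simp only [Finset.sum_sub_distrib, Finset.sum_add_distrib, ← Finset.mul_sum] at key
    simp only [← Finset.mul_sum] at a1 a2 b1 b2 h
    linarith
  · have key : ∑ k, ∑ l, (s k + s l) ^ 2 * α k l ^ 2 ≤
        ∑ k, ∑ l, (2 * (s k ^ 2 * α k l ^ 2) + 2 * (s l ^ 2 * α k l ^ 2)) := by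
      refine Finset.sum_le_sum fun k _ => Finset.sum_le_sum fun l _ => ?_
      have h2 := mul_nonneg (sq_nonneg (s k - s l)) (sq_nonneg (α k l))
      linarith
    simp only [Finset.sum_add_distrib, ← Finset.mul_sum] at key
    simp only [← Finset.mul_sum] at a1 a2
    linarith

/-- Cauchy–Schwarz on the factorization `s_k² - s_l² = (s_k - s_l)(s_k + s_l)`. Only the first
factor is small, so `δ` becomes `√δ`; this loss leads to the exponent `1/4`. -/
theorem sum_max_sq_sub_sq_le {ι : Type*} [Fintype ι] {s : ι → ℝ} (hs : ∀ k, 0 ≤ s k)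
    {α : ι → ι → ℝ} {δ : ℝ} (h1 : ∑ k, ∑ l, (s k - s l) ^ 2 * α k l ^ 2 ≤ 4 * δ)
    (h2 : ∑ k, ∑ l, (s k + s l) ^ 2 * α k l ^ 2 ≤ 4) :
    ∑ k, ∑ l, max (s k ^ 2 - s l ^ 2) 0 * α k l ^ 2 ≤ 4 * √δ := by
  rw [← Finset.sum_product'] at h1 h2 ⊢
  have hcs := Real.sum_mul_le_sqrt_mul_sqrt (Finset.univ ×ˢ Finset.univ)
    (fun q : ι × ι => |s q.1 - s q.2| * |α q.1 q.2|) (fun q => (s q.1 + s q.2) * |α q.1 q.2|)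
  simp only [mul_pow, sq_abs] at hcs
  have hle : √(∑ q ∈ (Finset.univ ×ˢ Finset.univ : Finset (ι × ι)),
      (s q.1 - s q.2) ^ 2 * α q.1 q.2 ^ 2) * √(∑ q ∈ (Finset.univ ×ˢ Finset.univ : Finset (ι × ι)),
      (s q.1 + s q.2) ^ 2 * α q.1 q.2 ^ 2) ≤ √(4 * δ) * √4 := by gcongr
  have h4 : √(4 * δ) * √4 = 4 * √δ := by
    rw [Real.sqrt_mul (by norm_num), mul_right_comm, Real.mul_self_sqrt (by norm_num)]
  refine le_trans (Finset.sum_le_sum fun q _ => ?_) ((hcs.trans hle).trans_eq h4)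
  have e : |s q.1 - s q.2| * |α q.1 q.2| * ((s q.1 + s q.2) * |α q.1 q.2|) =
      |s q.1 - s q.2| * (s q.1 + s q.2) * α q.1 q.2 ^ 2 := by
    rw [← sq_abs (α q.1 q.2)]; ring
  rw [e]
  refine mul_le_mul_of_nonneg_right (max_le ?_ ?_) (sq_nonneg _)
  · have := mul_le_mul_of_nonneg_right (le_abs_self (s q.1 - s q.2)) (add_nonneg (hs q.1) (hs q.2))
    linarith
  · exact mul_nonneg (abs_nonneg _) (add_nonneg (hs _) (hs _))

/-- Bessel's inequality for a pairwise orthogonal family of vectors of norm at most one. -/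
theorem sum_norm_inner_sq_le {L ι : Type*} [NormedAddCommGroup L] [InnerProductSpace ℂ L]
    [Fintype ι] {g : ι → L} (hg : ∀ k l, k ≠ l → inner ℂ (g k) (g l) = 0) (hg1 : ∀ k, ‖g k‖ ≤ 1)
    (x : L) : ∑ l, ‖inner ℂ (g l) x‖ ^ 2 ≤ ‖x‖ ^ 2 := by
  classical
  set y : L := ∑ l, inner ℂ (g l) x • g l with hy
  have h1 : inner ℂ y x = ((∑ l, ‖inner ℂ (g l) x‖ ^ 2 : ℝ) : ℂ) := by
    rw [hy, sum_inner]
    push_cast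
    refine Finset.sum_congr rfl fun l _ => ?_
    rw [inner_smul_left, RCLike.conj_mul]
    rfl
  have h2 : inner ℂ y y = ((∑ l, ‖inner ℂ (g l) x‖ ^ 2 * ‖g l‖ ^ 2 : ℝ) : ℂ) := by
    conv_lhs => rw [hy, sum_inner]
    push_cast
    refine Finset.sum_congr rfl fun l _ => ?_
    rw [inner_sum, Finset.sum_eq_single l]
    · rw [inner_smul_left, inner_smul_right, inner_self_eq_norm_sq_to_K, ← mul_assoc,
        RCLike.conj_mul]
      rfl
    · intro k _ hk
      rw [inner_smul_left, inner_smul_right, hg l k hk.symm]; simp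
    · simp
  have h3 := norm_sub_sq (𝕜 := ℂ) y x
  rw [← inner_self_eq_norm_sq (𝕜 := ℂ) y, h2, h1] at h3
  simp only [RCLike.re_to_complex, Complex.ofReal_re] at h3
  have h4 : ∑ l, ‖inner ℂ (g l) x‖ ^ 2 * ‖g l‖ ^ 2 ≤ ∑ l, ‖inner ℂ (g l) x‖ ^ 2 := by
    refine Finset.sum_le_sum fun l _ => mul_le_of_le_one_right (sq_nonneg _) ?_
    exact pow_le_one₀ (norm_nonneg _) (hg1 l)
  nlinarith [sq_nonneg ‖y - x‖]

end Overlap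

/-! ### Observables as self-adjoint isometries. -/

namespace LinearSystem.IsObservable

variable {H : Type} [NormedAddCommGroup H] [InnerProductSpace ℂ H] [CompleteSpace H]
  {X : H →L[ℂ] H}

theorem inner_map (hX : IsObservable X) (x y : H) : inner ℂ (X x) y = inner ℂ x (X y) :=
  (ContinuousLinearMap.isSelfAdjoint_iff_isSymmetric.1 hX.isSelfAdjoint) x y

theorem map_map (hX : IsObservable X) (x : H) : X (X x) = x :=
  congrArg (fun T : H →L[ℂ] H => T x) hX.sq_eq_one

theorem norm_map (hX : IsObservable X) (x : H) : ‖X x‖ = ‖x‖ := by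
  have : ‖X x‖ ^ 2 = ‖x‖ ^ 2 := by
    rw [← inner_self_eq_norm_sq (𝕜 := ℂ), ← inner_self_eq_norm_sq (𝕜 := ℂ), hX.inner_map,
      hX.map_map]
  exact (pow_left_inj₀ (norm_nonneg _) (norm_nonneg _) two_ne_zero).1 this

theorem norm_le_one (hX : IsObservable X) : ‖X‖ ≤ 1 :=
  ContinuousLinearMap.opNorm_le_bound _ zero_le_one fun x => by rw [hX.norm_map, one_mul]

theorem one : IsObservable (1 : H →L[ℂ] H) :=
  ⟨IsSelfAdjoint.one _, one_mul 1⟩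

end LinearSystem.IsObservable

/-! ### Schmidt decomposition and correlated observables. -/

section Schmidt

variable {K L : Type} [NormedAddCommGroup K] [InnerProductSpace ℂ K] [NormedAddCommGroup L]
  [InnerProductSpace ℂ L]

/-- The Schmidt decomposition. -/
theorem exists_schmidt [FiniteDimensional ℂ K] (ψ : K ⊗[ℂ] L) :
    ∃ (u : OrthonormalBasis (Fin (Module.finrank ℂ K)) ℂ K) (v : Fin (Module.finrank ℂ K) → L),
      (∀ k l, k ≠ l → inner ℂ (v k) (v l) = 0) ∧ ψ = ∑ k, u k ⊗ₜ[ℂ] v k := by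
  set e := stdOrthonormalBasis ℂ K with he
  obtain ⟨w, hw⟩ : ∃ w : Fin (Module.finrank ℂ K) → L, ψ = ∑ k, e k ⊗ₜ[ℂ] w k := by
    refine ⟨fun k => TensorProduct.equivFinsuppOfBasisLeft e.toBasis ψ k, ?_⟩
    conv_lhs => rw [← (TensorProduct.equivFinsuppOfBasisLeft e.toBasis).symm_apply_apply ψ,
      TensorProduct.equivFinsuppOfBasisLeft_symm_apply, Finsupp.sum_fintype _ _ (by simp)]
    simp
  -- A unitary `a` diagonalizing the Gram matrix of the `w k` makes their combinations orthogonal.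
  -- The conjugate change of basis on `K` leaves the tensor unchanged, because `a * aᴴ = 1`.
  set G : Matrix (Fin (Module.finrank ℂ K)) (Fin (Module.finrank ℂ K)) ℂ :=
    Matrix.of fun k l => inner ℂ (w k) (w l) with hG
  have hGh : G.IsHermitian := by
    ext k l
    simp [hG, Matrix.conjTranspose_apply]
  set a : Matrix (Fin (Module.finrank ℂ K)) (Fin (Module.finrank ℂ K)) ℂ :=
    ↑hGh.eigenvectorUnitary with ha
  have ha1 : aᴴ * a = 1 := Unitary.coe_star_mul_self hGh.eigenvectorUnitary
  have ha2 : a * aᴴ = 1 := Unitary.coe_mul_star_self hGh.eigenvectorUnitary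
  have hdiag : aᴴ * G * a = Matrix.diagonal fun k => (hGh.eigenvalues k : ℂ) := by
    have h1 := hGh.spectral_theorem
    rw [Unitary.conjStarAlgAut_apply] at h1
    have h2 : G = a * Matrix.diagonal (fun k => (hGh.eigenvalues k : ℂ)) * aᴴ := h1
    calc aᴴ * G * a = (aᴴ * a) * Matrix.diagonal (fun k => (hGh.eigenvalues k : ℂ)) * (aᴴ * a) := by
          conv_lhs => rw [h2]
          simp only [Matrix.mul_assoc]
      _ = _ := by rw [ha1, Matrix.one_mul, Matrix.mul_one]
  set u' : Fin (Module.finrank ℂ K) → K := fun k => ∑ l, starRingEnd ℂ (a l k) • e l with hu'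
  have hon : Orthonormal ℂ u' := by
    rw [orthonormal_iff_ite]
    intro k k'
    have h1 := congrFun (congrFun ha1 k') k
    rw [Matrix.mul_apply] at h1
    rw [hu', sum_inner]
    simp only [inner_sum, inner_smul_left, inner_smul_right, e.inner_eq_ite, mul_ite, mul_one,
      mul_zero, Finset.sum_ite_eq, Finset.mem_univ, if_true, Complex.conj_conj]
    rw [show (if k = k' then (1 : ℂ) else 0) = (1 : Matrix _ _ ℂ) k' k by
      simp [Matrix.one_apply, eq_comm], ← h1]
    exact Finset.sum_congr rfl fun l _ => by
      rw [Matrix.conjTranspose_apply]; rfl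
  refine ⟨OrthonormalBasis.mk hon ?_, fun k => ∑ l, a l k • w l, ?_, ?_⟩
  · exact (hon.linearIndependent.span_eq_top_of_card_eq_finrank' (by simp)).ge
  · intro k k' hkk
    have h1 := congrFun (congrFun hdiag k) k'
    rw [Matrix.diagonal_apply_ne _ hkk, Matrix.mul_apply] at h1
    rw [← h1, inner_sum]
    refine Finset.sum_congr rfl fun l _ => ?_
    rw [inner_smul_right, sum_inner, Matrix.mul_apply, mul_comm]
    congr 1
    refine Finset.sum_congr rfl fun l' _ => ?_
    rw [inner_smul_left]
    rfl
  · rw [hw]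
    simp only [OrthonormalBasis.coe_mk, hu', TensorProduct.sum_tmul, TensorProduct.tmul_sum,
      TensorProduct.smul_tmul_smul]
    rw [Finset.sum_comm]
    refine Finset.sum_congr rfl fun l _ => ?_
    rw [Finset.sum_comm]
    have h1 : ∀ y, ∑ x, starRingEnd ℂ (a y x) * a l x =
        (1 : Matrix (Fin (Module.finrank ℂ K)) (Fin (Module.finrank ℂ K)) ℂ) l y := by
      intro y
      rw [← ha2, Matrix.mul_apply]
      exact Finset.sum_congr rfl fun x _ => mul_comm _ (a l x)
    refine Eq.trans ?_ (Finset.sum_congr rfl fun y _ => Finset.sum_smul)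
    simp [h1, Matrix.one_apply]

variable {ι : Type} [Fintype ι]

theorem norm_sum_tmul_sq {v : ι → L} (hv : ∀ k l, k ≠ l → inner ℂ (v k) (v l) = 0) (x : ι → K) :
    ‖∑ k, x k ⊗ₜ[ℂ] v k‖ ^ 2 = ∑ k, ‖v k‖ ^ 2 * ‖x k‖ ^ 2 := by
  have h := tensor_inner_self (∑ k, x k ⊗ₜ[ℂ] v k)
  rw [tensor_sum_inner] at h
  classical
  have h2 : ∀ k, inner ℂ (x k ⊗ₜ[ℂ] v k) (∑ l, x l ⊗ₜ[ℂ] v l) =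
      ((‖v k‖ ^ 2 * ‖x k‖ ^ 2 : ℝ) : ℂ) := by
    intro k
    rw [tensor_inner_sum, Finset.sum_eq_single k]
    · rw [TensorProduct.inner_tmul, inner_self_eq_norm_sq_to_K, inner_self_eq_norm_sq_to_K]
      push_cast
      exact mul_comm _ _
    · intro l _ hl
      rw [TensorProduct.inner_tmul, hv k l hl.symm, mul_zero]
    · simp
  simp only [h2] at h
  exact_mod_cast h.symm

open LinearSystem in
/-- If the observables `Z` and `Q` are almost perfectly correlated in a state with Schmidt
decomposition `∑ u k ⊗ v k`, then `Z` almost commutes with the reduced density matrix. -/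
theorem sum_max_schmidt_le [CompleteSpace K] [CompleteSpace L] (u : OrthonormalBasis ι ℂ K)
    {v : ι → L} (hv : ∀ k l, k ≠ l → inner ℂ (v k) (v l) = 0) (hv1 : ∑ k, ‖v k‖ ^ 2 = 1)
    {Z : K →L[ℂ] K} (hZ : IsObservable Z) {Q : L →L[ℂ] L} (hQ : IsObservable Q) {δ : ℝ}
    (h : 1 - δ ≤ (inner ℂ (∑ k, u k ⊗ₜ[ℂ] v k)
      (TensorProduct.mapL Z Q (∑ k, u k ⊗ₜ[ℂ] v k))).re) :
    ∑ k, ∑ l, max (‖v k‖ ^ 2 - ‖v l‖ ^ 2) 0 * ‖inner ℂ (u l) (Z (u k))‖ ^ 2 ≤ 4 * √δ := by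
  -- Normalized Schmidt vectors, equal to `0` where `v k = 0` since `0⁻¹ = 0`. They may fail to be
  -- orthonormal, which is why Bessel is needed for norms at most one.
  let g : ι → L := fun k => ((‖v k‖⁻¹ : ℝ) : ℂ) • v k
  have hgv : ∀ k, v k = (‖v k‖ : ℂ) • g k := by
    intro k
    by_cases hk : v k = 0
    · simp [hk]
    · have : (‖v k‖ : ℂ) ≠ 0 := by simpa using hk
      simp [g, smul_smul, this]
  have hg : ∀ k l, k ≠ l → inner ℂ (g k) (g l) = 0 := by
    intro k l hkl
    simp [g, hv k l hkl]
  have hg1 : ∀ k, ‖g k‖ ≤ 1 := by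
    intro k
    by_cases hk : v k = 0
    · simp [g, hk]
    · have : ‖v k‖ ≠ 0 := by simpa using hk
      simp [g, norm_smul, this]
  have hsymm : ∀ {H : Type} [NormedAddCommGroup H] [InnerProductSpace ℂ H] [CompleteSpace H]
      {X : H →L[ℂ] H} (_ : IsObservable X) (x y : H),
      ‖inner ℂ x (X y)‖ = ‖inner ℂ y (X x)‖ := by
    intro H _ _ _ X hX x y
    rw [← hX.inner_map, norm_inner_symm]
  have hov : 1 - δ ≤ ∑ k, ∑ l, ‖v k‖ * ‖v l‖ *
      (‖inner ℂ (u l) (Z (u k))‖ * ‖inner ℂ (g l) (Q (g k))‖) := by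
    refine h.trans ?_
    rw [map_sum, tensor_inner_sum]
    refine (Complex.re_le_norm _).trans ((norm_sum_le _ _).trans ?_)
    refine Finset.sum_le_sum fun k _ => ?_
    rw [tensor_sum_inner]
    refine (norm_sum_le _ _).trans (Finset.sum_le_sum fun l _ => le_of_eq ?_)
    rw [TensorProduct.mapL_tmul, TensorProduct.inner_tmul, norm_mul, hgv k, hgv l, map_smul,
      inner_smul_left, inner_smul_right, ← hgv k, ← hgv l]
    simp only [norm_mul, RCLike.norm_conj, Complex.norm_real, norm_norm]
    ring
  have hcore := sum_sub_sq_mul_sq_le (s := fun k => ‖v k‖) hv1 (fun k => norm_nonneg _)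
    (α := fun k l => ‖inner ℂ (u l) (Z (u k))‖) (β := fun k l => ‖inner ℂ (g l) (Q (g k))‖)
    (fun k l => hsymm hZ _ _) (fun k l => hsymm hQ _ _)
    (fun k => by
      have := u.sum_sq_norm_inner_right (Z (u k))
      rw [this, hZ.norm_map, u.norm_eq_one, one_pow])
    (fun k => (sum_norm_inner_sq_le hg hg1 _).trans (by
      rw [hQ.norm_map]; exact pow_le_one₀ (norm_nonneg _) (hg1 k))) hov
  exact sum_max_sq_sub_sq_le (fun k => norm_nonneg _) hcore.1 hcore.2

end Schmidt

/-! ### From strategies to approximate representations. -/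

namespace LinearSystem

section State

variable {K L : Type} [NormedAddCommGroup K] [InnerProductSpace ℂ K] [NormedAddCommGroup L]
  [InnerProductSpace ℂ L]

/-- In the Schmidt basis the operators on `K` become matrices and the squared norms `‖v k‖²` become
the weights. Correlation with some `Q` bounds the leakage, and `hT` is the weighted defect of the
relations, as `exists_rounded_involutions` requires. -/
theorem hyperlinearProfile_le_of_state {m n : ℕ} {A : Matrix (Fin m) (Fin n) (ZMod 2)}
    {b : Fin m → ZMod 2} [FiniteDimensional ℂ K] [CompleteSpace K] [CompleteSpace L]
    {ψ : K ⊗[ℂ] L} (hψ : ‖ψ‖ = 1) {Z : Fin n → K →L[ℂ] K} (hZ : ∀ j, IsObservable (Z j))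
    {δ τ : ℝ} (hτ : 0 < τ) (hδτ : 4 * √δ ≤ τ)
    (hQ : ∀ j, ∃ Q : L →L[ℂ] L, IsObservable Q ∧
      1 - δ ≤ (inner ℂ ψ (TensorProduct.mapL (Z j) Q ψ)).re)
    (hT : ∀ q ∈ relatorWords A b,
      ‖TensorProduct.mapL ((q.1.map Z).prod - (-1) ^ q.2) (1 : L →L[ℂ] L) ψ‖ ^ 2 ≤ τ)
    {N : ℕ} (hN : ∀ q ∈ relatorWords A b, q.1.length ≤ N) :
    hyperlinearProfile (solutionRelators A b) {genJ n} 2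
      ((2 * N + 1) * √((n + (relatorWords A b).card + 1) * τ)) ≤ Module.finrank ℂ K := by
  obtain ⟨u, v, hv, rfl⟩ := exists_schmidt ψ
  let μ : (K →L[ℂ] K) →+* Matrix (Fin (Module.finrank ℂ K)) (Fin (Module.finrank ℂ K)) ℂ :=
    ((LinearMap.toMatrixOrthonormal u).toRingEquiv : _ →+* _).comp
      ContinuousLinearMap.toLinearMapRingHom
  have hμ : ∀ T l k, μ T l k = inner ℂ (u l) (T (u k)) := fun T l k =>
    LinearMap.toMatrixOrthonormal_apply_apply u (T : K →ₗ[ℂ] K) l k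
  have hnorm : ∀ T : K →L[ℂ] K, ‖TensorProduct.mapL T (1 : L →L[ℂ] L) (∑ k, u k ⊗ₜ[ℂ] v k)‖ ^ 2 =
      ∑ k, ‖v k‖ ^ 2 * ∑ l, ‖μ T l k‖ ^ 2 := by
    intro T
    rw [map_sum]
    refine (norm_sum_tmul_sq hv fun k => T (u k)).trans (Finset.sum_congr rfl fun k _ => ?_)
    simp only [hμ]
    rw [u.sum_sq_norm_inner_right]
  have hv1 : ∑ k, ‖v k‖ ^ 2 = 1 := by
    have h := norm_sum_tmul_sq hv u
    rw [hψ] at h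
    simpa using h.symm
  have hμZ : ∀ j, IsHermitianInvolution (μ (Z j)) := by
    intro j
    refine ⟨?_, by rw [← map_mul, (hZ j).sq_eq_one, map_one]⟩
    ext k l
    rw [Matrix.conjTranspose_apply, hμ, hμ, ← (hZ j).inner_map, ← inner_conj_symm]
    exact Complex.conj_conj _
  have hprod : ∀ q : List (Fin n) × ℕ, μ ((q.1.map Z).prod - (-1) ^ q.2) =
      (q.1.map fun j => μ (Z j)).prod - (-1) ^ q.2 := by
    intro q
    rw [map_sub, map_list_prod, List.map_map, map_pow, map_neg, map_one]
    rfl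
  obtain ⟨r, hr0, hr, U, hU, hUT⟩ := exists_rounded_involutions hμZ (fun k => ‖v k‖ ^ 2)
    (fun k => sq_nonneg _) hv1 (relatorWords A b) hN hτ
    (fun j => by
      obtain ⟨Q, hQo, hQδ⟩ := hQ j
      simp only [hμ]
      exact (sum_max_schmidt_le u hv hv1 (hZ j) hQo hQδ).trans hδτ)
    (fun q hq => by
      have := hT q hq
      rwa [hnorm, hprod] at this)
  rw [Fintype.card_fin] at hr hUT
  exact (hyperlinearProfile_le_of_involutions hr0 (by positivity) hU hUT).trans
    (by exact_mod_cast hr)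

theorem inner_mapL_left [CompleteSpace K] {Z : K →L[ℂ] K} (hZ : IsObservable Z)
    (x y : K ⊗[ℂ] L) : inner ℂ (TensorProduct.mapL Z (1 : L →L[ℂ] L) x) y =
      inner ℂ x (TensorProduct.mapL Z (1 : L →L[ℂ] L) y) := by
  obtain ⟨s, rfl⟩ := TensorProduct.exists_finset x
  obtain ⟨t, rfl⟩ := TensorProduct.exists_finset y
  simp only [map_sum, tensor_sum_inner, tensor_inner_sum, TensorProduct.mapL_tmul,
    TensorProduct.inner_tmul, hZ.inner_map, one_apply_eq_self]

theorem mapL_one_mul_one_mapL (Z : K →L[ℂ] K) (Q : L →L[ℂ] L) :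
    TensorProduct.mapL Z 1 * TensorProduct.mapL 1 Q = TensorProduct.mapL Z Q := by
  rw [← TensorProduct.mapL_mul, one_mul, mul_one]

theorem one_mapL_mul_mapL_one (Z : K →L[ℂ] K) (Q : L →L[ℂ] L) :
    TensorProduct.mapL 1 Q * TensorProduct.mapL Z 1 = TensorProduct.mapL Z Q := by
  rw [← TensorProduct.mapL_mul, one_mul, mul_one]

theorem norm_mapL_le_one [CompleteSpace K] [CompleteSpace L] {Z : K →L[ℂ] K}
    (hZ : IsObservable Z) {Q : L →L[ℂ] L} (hQ : IsObservable Q) :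
    ‖TensorProduct.mapL Z Q‖ ≤ 1 :=
  (TensorProduct.norm_mapL_le Z Q).trans
    (mul_le_one₀ hZ.norm_le_one (norm_nonneg _) hQ.norm_le_one)

theorem norm_mapL_apply_le [CompleteSpace K] [CompleteSpace L] {Z : K →L[ℂ] K}
    (hZ : IsObservable Z) {Q : L →L[ℂ] L} (hQ : IsObservable Q) (x : K ⊗[ℂ] L) :
    ‖TensorProduct.mapL Z Q x‖ ≤ ‖x‖ :=
  (ContinuousLinearMap.le_of_opNorm_le _ (norm_mapL_le_one hZ hQ) x).trans_eq (one_mul _)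

/-- Almost perfectly correlated observables act almost identically on the state. -/
theorem norm_mapL_sub_le [CompleteSpace K] [CompleteSpace L] {ψ : K ⊗[ℂ] L} (hψ : ‖ψ‖ = 1)
    {Z : K →L[ℂ] K} (hZ : IsObservable Z) {Q : L →L[ℂ] L} (hQ : IsObservable Q) {δ : ℝ}
    (h : 1 - δ ≤ (inner ℂ ψ (TensorProduct.mapL Z Q ψ)).re) :
    ‖TensorProduct.mapL Z (1 : L →L[ℂ] L) ψ - TensorProduct.mapL (1 : K →L[ℂ] K) Q ψ‖ ≤
      √(2 * δ) := by
  refine Real.le_sqrt_of_sq_le ?_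
  set x := TensorProduct.mapL Z (1 : L →L[ℂ] L) ψ with hx
  set y := TensorProduct.mapL (1 : K →L[ℂ] K) Q ψ with hy
  have h1 : ‖x - y‖ ^ 2 = ‖x‖ ^ 2 - 2 * (inner ℂ x y).re + ‖y‖ ^ 2 := by
    exact norm_sub_sq (𝕜 := ℂ) (E := K ⊗[ℂ] L) x y
  have h2 : inner ℂ x y = inner ℂ ψ (TensorProduct.mapL Z Q ψ) := by
    rw [hx, inner_mapL_left hZ, hy, ← mul_apply_eq_comp, mapL_one_mul_one_mapL]
  have h3 : ‖x‖ ≤ 1 := hψ ▸ norm_mapL_apply_le hZ .one ψ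
  have h4 : ‖y‖ ≤ 1 := hψ ▸ norm_mapL_apply_le .one hQ ψ
  have h5 := pow_le_one₀ (norm_nonneg x) h3 (n := 2)
  have h6 := pow_le_one₀ (norm_nonneg y) h4 (n := 2)
  rw [h1, h2]
  linarith

theorem abs_re_inner_mapL_le [CompleteSpace K] [CompleteSpace L] {ψ : K ⊗[ℂ] L} (hψ : ‖ψ‖ = 1)
    {Z : K →L[ℂ] K} (hZ : IsObservable Z) {Q : L →L[ℂ] L} (hQ : IsObservable Q) :
    |(inner ℂ ψ (TensorProduct.mapL Z Q ψ)).re| ≤ 1 := by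
  have h1 : ‖inner ℂ ψ (TensorProduct.mapL Z Q ψ)‖ ≤ ‖ψ‖ * ‖TensorProduct.mapL Z Q ψ‖ := by
    exact norm_inner_le_norm (𝕜 := ℂ) (E := K ⊗[ℂ] L) _ _
  have h2 := norm_mapL_apply_le hZ hQ ψ
  rw [hψ] at h1 h2
  have h3 := Complex.abs_re_le_norm (inner ℂ ψ (TensorProduct.mapL Z Q ψ))
  linarith

theorem list_prod_mapL_left {α : Type*} (Z : α → K →L[ℂ] K) (w : List α) :
    (w.map fun j => TensorProduct.mapL (Z j) (1 : L →L[ℂ] L)).prod =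
      TensorProduct.mapL (w.map Z).prod 1 := by
  induction w with
  | nil => exact TensorProduct.mapL_id_id.symm
  | cons a w ih =>
    simp only [List.map_cons, List.prod_cons]
    rw [ih, ← TensorProduct.mapL_mul, one_mul]

theorem list_prod_mapL_right {α : Type*} (Q : α → L →L[ℂ] L) (w : List α) :
    (w.map fun j => TensorProduct.mapL (1 : K →L[ℂ] K) (Q j)).prod =
      TensorProduct.mapL 1 (w.map Q).prod := by
  induction w with
  | nil => exact TensorProduct.mapL_id_id.symm
  | cons a w ih =>
    simp only [List.map_cons, List.prod_cons]
    rw [ih, ← TensorProduct.mapL_mul, one_mul]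

/-- The letter next to `ψ` is replaced by its partner, which commutes with the remaining `P`s and is
moved out to their left. Hence the order reverses. -/
theorem norm_list_prod_apply_sub_le {H α : Type*} [NormedAddCommGroup H] [NormedSpace ℂ H]
    {P Q : α → H →L[ℂ] H} (hPQ : ∀ a c, P a * Q c = Q c * P a) {ψ : H} {θ : ℝ} (w : List α)
    (hP : ∀ a ∈ w, ‖P a‖ ≤ 1) (hQ : ∀ a ∈ w, ‖Q a‖ ≤ 1) (h : ∀ a ∈ w, ‖P a ψ - Q a ψ‖ ≤ θ) :
    ‖(w.map P).prod ψ - (w.reverse.map Q).prod ψ‖ ≤ w.length * θ := by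
  have contr : ∀ v : List α, (∀ a ∈ v, ‖Q a‖ ≤ 1) → ∀ x, ‖(v.map Q).prod x‖ ≤ ‖x‖ := by
    intro v hv x
    induction v with
    | nil => simp
    | cons a v ih =>
      rw [List.map_cons, List.prod_cons, mul_apply_eq_comp]
      refine (ContinuousLinearMap.le_of_opNorm_le _ (hv a List.mem_cons_self) _).trans ?_
      rw [one_mul]
      exact ih fun c hc => hv c (List.mem_cons_of_mem _ hc)
  induction w with
  | nil => simp
  | cons a w ih =>
    have h1 := ih (fun c hc => hP c (List.mem_cons_of_mem _ hc))
      (fun c hc => hQ c (List.mem_cons_of_mem _ hc)) (fun c hc => h c (List.mem_cons_of_mem _ hc))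
    have hcomm : P a * (w.reverse.map Q).prod = (w.reverse.map Q).prod * P a := by
      refine (Commute.list_prod_right _ _ ?_).eq
      intro x hx
      obtain ⟨c, -, rfl⟩ := List.mem_map.1 hx
      exact hPQ a c
    have e : ((a :: w).map P).prod ψ - ((a :: w).reverse.map Q).prod ψ =
        P a ((w.map P).prod ψ - (w.reverse.map Q).prod ψ) +
          (w.reverse.map Q).prod (P a ψ - Q a ψ) := by
      have h2 : P a ((w.reverse.map Q).prod ψ) = (w.reverse.map Q).prod (P a ψ) :=
        congrArg (fun T : H →L[ℂ] H => T ψ) hcomm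
      rw [map_sub, map_sub, h2]
      simp
    rw [e]
    refine (norm_add_le _ _).trans ?_
    have h2 := ContinuousLinearMap.le_of_opNorm_le _ (hP a List.mem_cons_self)
      ((w.map P).prod ψ - (w.reverse.map Q).prod ψ)
    have h3 := contr w.reverse
      (fun c hc => hQ c (List.mem_cons_of_mem _ (List.mem_reverse.1 hc))) (P a ψ - Q a ψ)
    have h4 := h a List.mem_cons_self
    rw [List.length_cons]
    push_cast
    linarith

theorem norm_word_sub_reverse_le [CompleteSpace K] [CompleteSpace L] {α : Type*} {ψ : K ⊗[ℂ] L}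
    (hψ : ‖ψ‖ = 1) {Z : α → K →L[ℂ] K} {Q : α → L →L[ℂ] L} {δ : ℝ} (w : List α)
    (hZ : ∀ j ∈ w, IsObservable (Z j)) (hQ : ∀ j ∈ w, IsObservable (Q j))
    (h : ∀ j ∈ w, 1 - δ ≤ (inner ℂ ψ (TensorProduct.mapL (Z j) (Q j) ψ)).re) :
    ‖TensorProduct.mapL (w.map Z).prod 1 ψ - TensorProduct.mapL 1 (w.reverse.map Q).prod ψ‖ ≤
      w.length * √(2 * δ) := by
  rw [← list_prod_mapL_left, ← list_prod_mapL_right]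
  refine norm_list_prod_apply_sub_le
    (P := fun j => TensorProduct.mapL (Z j) (1 : L →L[ℂ] L))
    (Q := fun j => TensorProduct.mapL (1 : K →L[ℂ] K) (Q j)) (fun a c => ?_) w
    (fun a ha => norm_mapL_le_one (hZ a ha) .one) (fun a ha => norm_mapL_le_one .one (hQ a ha))
    (fun a ha => norm_mapL_sub_le hψ (hZ a ha) (hQ a ha) (h a ha))
  rw [mapL_one_mul_one_mapL, one_mapL_mul_mapL_one]

theorem mapL_sub_neg_one_pow (T : K →L[ℂ] K) (k : ℕ) (ψ : K ⊗[ℂ] L) :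
    TensorProduct.mapL (T - (-1) ^ k) (1 : L →L[ℂ] L) ψ =
      TensorProduct.mapL T 1 ψ - (-1 : ℂ) ^ k • ψ := by
  obtain ⟨s, rfl⟩ := TensorProduct.exists_finset ψ
  have : ∀ x : K, ((-1 : K →L[ℂ] K) ^ k) x = (-1 : ℂ) ^ k • x := by
    intro x
    rcases Nat.even_or_odd k with h | h <;> simp [h.neg_one_pow]
  simp only [map_sum, Finset.smul_sum, ← Finset.sum_sub_distrib, TensorProduct.mapL_tmul,
    sub_apply, this, TensorProduct.sub_tmul, TensorProduct.smul_tmul',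
    one_apply_eq_self]

theorem mapL_one_neg_one_pow (k : ℕ) (ψ : K ⊗[ℂ] L) :
    TensorProduct.mapL (1 : K →L[ℂ] K) ((-1 : L →L[ℂ] L) ^ k) ψ = (-1 : ℂ) ^ k • ψ := by
  have h1 : TensorProduct.mapL (1 : K →L[ℂ] K) (1 : L →L[ℂ] L) = .id ℂ _ :=
    TensorProduct.mapL_id_id
  have h2 : (-1 : L →L[ℂ] L) ^ k = (-1 : ℂ) ^ k • 1 := by
    rcases Nat.even_or_odd k with h | h <;> simp [h.neg_one_pow]
  rw [h2, TensorProduct.mapL_smul_right, h1]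
  rfl

theorem inner_comm_mapL_comm (ψ : K ⊗[ℂ] L) (Y : K →L[ℂ] K) (X : L →L[ℂ] L) :
    inner ℂ (TensorProduct.comm ℂ K L ψ)
      (TensorProduct.mapL X Y (TensorProduct.comm ℂ K L ψ)) =
      inner ℂ ψ (TensorProduct.mapL Y X ψ) := by
  rw [← TensorProduct.inner_comm_comm ψ]
  congr 1
  obtain ⟨s, rfl⟩ := TensorProduct.exists_finset ψ
  simp only [map_sum, TensorProduct.comm_tmul, TensorProduct.mapL_tmul]

end State

theorem finrank_of_edim_eq {H : Type} [AddCommGroup H] [Module ℂ H] {d : ℕ} (h : edim H = d) :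
    FiniteDimensional ℂ H ∧ Module.finrank ℂ H = d := by
  have h1 : Module.rank ℂ H = d := Cardinal.toENat_eq_natCast.1 h
  exact ⟨Module.rank_lt_aleph0_iff.1 (h1 ▸ Cardinal.natCast_lt_aleph0),
    Module.finrank_eq_of_rank_eq h1⟩

section Strategy

variable {m n : ℕ} {A : Matrix (Fin m) (Fin n) (ZMod 2)} {b : Fin m → ZMod 2} {HA HB : Type}
  [NormedAddCommGroup HA] [InnerProductSpace ℂ HA] [CompleteSpace HA]
  [NormedAddCommGroup HB] [InnerProductSpace ℂ HB] [CompleteSpace HB]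

theorem Strategy.abs_bias_le_one (S : Strategy A b HA HB) {i : Fin m} {j : Fin n}
    (hij : A i j ≠ 0) : |S.bias i j| ≤ 1 :=
  abs_re_inner_mapL_le S.norm_ψ (S.Y_observable i j hij) (S.X_observable j)

theorem Strategy.winProb_nonneg (S : Strategy A b HA HB) : 0 ≤ S.winProb := by
  refine div_nonneg (Finset.sum_nonneg fun i _ => Finset.sum_nonneg fun j _ => ?_) (by positivity)
  rw [Strategy.winProbOn]
  split_ifs with hij
  · have := (abs_le.1 (S.abs_bias_le_one hij)).1
    linarith
  · exact zero_le_one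

/-- The losing probabilities are nonnegative and sum to at most `mnε`, so each is at most that;
passing to the bias doubles it. -/
theorem Strategy.le_bias (S : Strategy A b HA HB) (hm : 0 < m) (hn : 0 < n) {ε : ℝ}
    (h : 1 - ε ≤ S.winProb) {i : Fin m} {j : Fin n} (hij : A i j ≠ 0) :
    1 - 2 * (m * n * ε) ≤ S.bias i j := by
  have hmn : (0 : ℝ) < m * n := by positivity
  rw [Strategy.winProb, le_div_iff₀ hmn] at h
  have hle : ∀ i j, 0 ≤ 1 - S.winProbOn i j := by
    intro i j
    rw [Strategy.winProbOn]
    split_ifs with hij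
    · have := (abs_le.1 (S.abs_bias_le_one hij)).2
      linarith
    · simp
  have h1 : ∑ i, ∑ j, (1 - S.winProbOn i j) = m * n - ∑ i, ∑ j, S.winProbOn i j := by
    simp
  have h2 : 1 - S.winProbOn i j ≤ ∑ i, ∑ j, (1 - S.winProbOn i j) :=
    (Finset.single_le_sum (f := fun j => 1 - S.winProbOn i j) (fun j _ => hle i j)
      (Finset.mem_univ j)).trans
      (Finset.single_le_sum (f := fun i => ∑ j, (1 - S.winProbOn i j))
        (fun i _ => Finset.sum_nonneg fun j _ => hle i j) (Finset.mem_univ i))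
  rw [Strategy.winProbOn, if_pos hij] at h2
  linarith

theorem length_le_of_mem_relatorWords {q : List (Fin n) × ℕ} (hq : q ∈ relatorWords A b) :
    q.1.length ≤ n + 4 := by
  rcases of_mem_relatorWords hq with ⟨i, rfl⟩ | ⟨i, j, k, -, -, rfl⟩
  · exact (length_support_le A i).trans (Nat.le_add_right _ _)
  · simp

/-- The letters of a relator word lie in one equation, for which Alice's operators are an exact
solution. The reversed word is the inverse, and `(-1) ^ k` is its own inverse; the reversed form is
needed when the rounding is done on Bob's side. -/
theorem Strategy.relator_eq (S : Strategy A b HA HB) {q : List (Fin n) × ℕ}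
    (hq : q ∈ relatorWords A b) : ∃ i, (∀ j ∈ q.1, A i j ≠ 0) ∧
      (q.1.map (S.Y i)).prod = (-1) ^ q.2 ∧ (q.1.reverse.map (S.Y i)).prod = (-1) ^ q.2 := by
  have hrev : ∀ (i : Fin m) (w : List (Fin n)), (∀ j ∈ w, A i j ≠ 0) →
      (w.map (S.Y i)).prod * (w.reverse.map (S.Y i)).prod = 1 := by
    intro i w hw
    induction w with
    | nil => simp
    | cons a w ih =>
      have h1 := ih fun j hj => hw j (List.mem_cons_of_mem _ hj)
      simp only [List.map_cons, List.prod_cons, List.reverse_cons, List.map_append,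
        List.prod_append, List.map_nil, List.prod_nil, mul_one]
      rw [mul_assoc, ← mul_assoc _ _ (S.Y i a), h1, one_mul,
        (S.Y_observable i a (hw a List.mem_cons_self)).sq_eq_one]
  have main : ∃ i, (∀ j ∈ q.1, A i j ≠ 0) ∧ (q.1.map (S.Y i)).prod = (-1) ^ q.2 := by
    rcases of_mem_relatorWords hq with ⟨i, rfl⟩ | ⟨i, j, k, hj, hk, rfl⟩
    · exact ⟨i, fun j hj => mem_support.1 hj, S.Y_prod i⟩
    · refine ⟨i, by simp [hj, hk], ?_⟩
      simp only [List.map_cons, List.prod_cons, List.map_nil, List.prod_nil, mul_one, pow_zero]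
      rw [← mul_assoc (S.Y i k), ← S.Y_comm i j k hj hk, mul_assoc,
        (S.Y_observable i k hk).sq_eq_one, mul_one, (S.Y_observable i j hj).sq_eq_one]
  obtain ⟨i, h1, h2⟩ := main
  refine ⟨i, h1, h2, ?_⟩
  have h3 := hrev i q.1 h1
  rw [h2] at h3
  calc (q.1.reverse.map (S.Y i)).prod
      = ((-1) ^ q.2 * (-1) ^ q.2) * (q.1.reverse.map (S.Y i)).prod := by
        rw [← pow_add, ← two_mul, pow_mul, neg_one_sq, one_pow, one_mul]
    _ = _ := by rw [mul_assoc, h3, mul_one]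

open Classical in
/-- Alice's observable for the variable `j`, read off from some equation that contains it. -/
def Strategy.aliceObservable (S : Strategy A b HA HB) (j : Fin n) : HA →L[ℂ] HA :=
  if h : ∃ i, A i j ≠ 0 then S.Y h.choose j else 1

open Classical in
/-- Bob's observable for the variable `j` if it appears in some equation. -/
def Strategy.bobObservable (S : Strategy A b HA HB) (j : Fin n) : HB →L[ℂ] HB :=
  if ∃ i, A i j ≠ 0 then S.X j else 1

/-- The operators chosen for the variables of a word may come from different equations. The word is
carried to Bob's reversed word and back to Alice's operators for a single equation, where it is
exact. Two crossings of at most `n + 4` letters give `8 (n + 4)² δ`. -/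
theorem Strategy.hyperlinearProfile_le_finrank_left [FiniteDimensional ℂ HA]
    (S : Strategy A b HA HB) {δ τ : ℝ} (hδ : 0 ≤ δ) (hτ : 0 < τ) (h1 : 4 * √δ ≤ τ)
    (h2 : 8 * (n + 4) ^ 2 * δ ≤ τ) (hS : ∀ i j, A i j ≠ 0 → 1 - δ ≤ S.bias i j) :
    hyperlinearProfile (solutionRelators A b) {genJ n} 2
      ((2 * (n + 4 : ℕ) + 1) * √((n + (relatorWords A b).card + 1) * τ)) ≤
        Module.finrank ℂ HA := by
  have hZ : ∀ j, IsObservable (S.aliceObservable j) := by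
    intro j
    rw [Strategy.aliceObservable]
    split_ifs with h
    · exact S.Y_observable _ j h.choose_spec
    · exact .one
  have hZX : ∀ i j, A i j ≠ 0 →
      1 - δ ≤ (inner ℂ S.ψ (TensorProduct.mapL (S.aliceObservable j) (S.X j) S.ψ)).re := by
    intro i j hij
    have h : ∃ i, A i j ≠ 0 := ⟨i, hij⟩
    rw [Strategy.aliceObservable, dif_pos h]
    exact hS _ j h.choose_spec
  refine hyperlinearProfile_le_of_state S.norm_ψ hZ hτ h1 (fun j => ?_) (fun q hq => ?_)
    (fun q hq => length_le_of_mem_relatorWords hq)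
  · by_cases h : ∃ i, A i j ≠ 0
    · obtain ⟨i, hij⟩ := h
      exact ⟨S.X j, S.X_observable j, hZX i j hij⟩
    · refine ⟨1, .one, ?_⟩
      have e : TensorProduct.mapL (1 : HA →L[ℂ] HA) (1 : HB →L[ℂ] HB) = .id ℂ _ :=
        TensorProduct.mapL_id_id
      rw [Strategy.aliceObservable, dif_neg h, e, ContinuousLinearMap.id_apply, tensor_inner_self,
        S.norm_ψ]
      simpa using hδ
  · obtain ⟨i, hqi, hfwd, -⟩ := S.relator_eq hq
    have e1 := norm_word_sub_reverse_le S.norm_ψ (δ := δ) q.1 (fun j _ => hZ j)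
      (fun j _ => S.X_observable j) (fun j hj => hZX i j (hqi j hj))
    have e2 := norm_word_sub_reverse_le S.norm_ψ (δ := δ) (Z := S.Y i) (Q := S.X) q.1
      (fun j hj => S.Y_observable i j (hqi j hj))
      (fun j _ => S.X_observable j) (fun j hj => hS i j (hqi j hj))
    rw [hfwd] at e2
    have e4 : TensorProduct.mapL ((-1 : HA →L[ℂ] HA) ^ q.2) (1 : HB →L[ℂ] HB) S.ψ =
        (-1 : ℂ) ^ q.2 • S.ψ := by
      have h := mapL_sub_neg_one_pow ((-1 : HA →L[ℂ] HA) ^ q.2) q.2 S.ψ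
      rw [sub_self, TensorProduct.mapL_zero_left] at h
      exact sub_eq_zero.1 h.symm
    rw [e4, norm_sub_rev] at e2
    rw [mapL_sub_neg_one_pow]
    have e5 := norm_sub_le_norm_sub_add_norm_sub
      (TensorProduct.mapL (q.1.map S.aliceObservable).prod (1 : HB →L[ℂ] HB) S.ψ)
      (TensorProduct.mapL (1 : HA →L[ℂ] HA) (q.1.reverse.map S.X).prod S.ψ) ((-1 : ℂ) ^ q.2 • S.ψ)
    have hl : (q.1.length : ℝ) * √(2 * δ) ≤ (n + 4) * √(2 * δ) := by
      have : (q.1.length : ℝ) ≤ n + 4 := by exact_mod_cast length_le_of_mem_relatorWords hq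
      gcongr
    calc _ ≤ (2 * ((n + 4) * √(2 * δ))) ^ 2 := by
          refine pow_le_pow_left₀ (norm_nonneg _) ?_ 2
          linarith
      _ = 8 * (n + 4) ^ 2 * δ := by
          rw [mul_pow, mul_pow, Real.sq_sqrt (by positivity)]; ring
      _ ≤ τ := h2

/-- After exchanging the tensor factors, one crossing carries Bob's word to Alice's reversed word
for a single equation, which is exact; the bound for two crossings is more than enough. -/
theorem Strategy.hyperlinearProfile_le_finrank_right [FiniteDimensional ℂ HB]
    (S : Strategy A b HA HB) {δ τ : ℝ} (hδ : 0 ≤ δ) (hτ : 0 < τ) (h1 : 4 * √δ ≤ τ)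
    (h2 : 8 * (n + 4) ^ 2 * δ ≤ τ) (hS : ∀ i j, A i j ≠ 0 → 1 - δ ≤ S.bias i j) :
    hyperlinearProfile (solutionRelators A b) {genJ n} 2
      ((2 * (n + 4 : ℕ) + 1) * √((n + (relatorWords A b).card + 1) * τ)) ≤
        Module.finrank ℂ HB := by
  set ψ := TensorProduct.comm ℂ HA HB S.ψ with hψdef
  have hψ : ‖ψ‖ = 1 := (TensorProduct.norm_comm S.ψ).trans S.norm_ψ
  have hZ : ∀ j, IsObservable (S.bobObservable j) := by
    intro j
    rw [Strategy.bobObservable]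
    split_ifs with h
    · exact S.X_observable j
    · exact .one
  have hZY : ∀ i j, A i j ≠ 0 →
      1 - δ ≤ (inner ℂ ψ (TensorProduct.mapL (S.bobObservable j) (S.Y i j) ψ)).re := by
    intro i j hij
    rw [Strategy.bobObservable, if_pos ⟨i, hij⟩, hψdef, inner_comm_mapL_comm]
    exact hS i j hij
  refine hyperlinearProfile_le_of_state hψ hZ hτ h1 (fun j => ?_) (fun q hq => ?_)
    (fun q hq => length_le_of_mem_relatorWords hq)
  · by_cases h : ∃ i, A i j ≠ 0
    · obtain ⟨i, hij⟩ := h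
      exact ⟨S.Y i j, S.Y_observable i j hij, hZY i j hij⟩
    · refine ⟨1, .one, ?_⟩
      have e : TensorProduct.mapL (1 : HB →L[ℂ] HB) (1 : HA →L[ℂ] HA) = .id ℂ _ :=
        TensorProduct.mapL_id_id
      rw [Strategy.bobObservable, if_neg h, e, ContinuousLinearMap.id_apply, tensor_inner_self, hψ]
      simpa using hδ
  · obtain ⟨i, hqi, -, hbwd⟩ := S.relator_eq hq
    have e1 := norm_word_sub_reverse_le hψ (δ := δ) q.1 (fun j _ => hZ j)
      (fun j hj => S.Y_observable i j (hqi j hj)) (fun j hj => hZY i j (hqi j hj))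
    rw [hbwd, mapL_one_neg_one_pow, ← mapL_sub_neg_one_pow] at e1
    have hl : (q.1.length : ℝ) * √(2 * δ) ≤ (n + 4) * √(2 * δ) := by
      have : (q.1.length : ℝ) ≤ n + 4 := by exact_mod_cast length_le_of_mem_relatorWords hq
      gcongr
    have hp : 0 ≤ (n + 4) * √(2 * δ) := by positivity
    calc _ ≤ (2 * ((n + 4) * √(2 * δ))) ^ 2 := by
          refine pow_le_pow_left₀ (norm_nonneg _) ?_ 2
          linarith
      _ = 8 * (n + 4) ^ 2 * δ := by
          rw [mul_pow, mul_pow, Real.sq_sqrt (by positivity)]; ring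
      _ ≤ τ := h2

end Strategy

/-- The constant in the construction of an approximate representation from a strategy, before
taking square roots. -/
def roundingConst (m n : ℕ) : ℝ := 4 * √(2 * (m * n)) + 16 * (n + 4) ^ 2 * (m * n)

theorem hyperlinearProfile_le_entanglement {m n : ℕ} (hm : 0 < m) (hn : 0 < n)
    (A : Matrix (Fin m) (Fin n) (ZMod 2)) (b : Fin m → ZMod 2) (hq : quantumValue A b = 1)
    {ε : ℝ} (hε : 0 < ε) :
    hyperlinearProfile (solutionRelators A b) {genJ n} 2
      ((2 * (n + 4 : ℕ) + 1) * √((n + (relatorWords A b).card + 1) * roundingConst m n) *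
        ε ^ (1 / 4 : ℝ)) ≤ entanglement A b ε := by
  refine le_sInf ?_
  rintro D ⟨d, rfl, p, ⟨HA, HB, _, _, _, _, _, _, S, hd, rfl⟩, hp⟩
  rw [hq] at hp
  -- Winning probabilities are nonnegative, so `ε` may be truncated at 1, which gives `ε' ≤ √ε'` and
  -- lets one `τ` dominate errors of orders `√δ` and `δ`.
  set ε' : ℝ := min ε 1 with hε'
  have hε'0 : 0 < ε' := lt_min hε one_pos
  have hp' : 1 - ε' ≤ S.winProb := by
    rcases min_choice ε 1 with h | h
    · rw [hε', h]; exact hp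
    · rw [hε', h, sub_self]; exact S.winProb_nonneg
  have hmn : (0 : ℝ) < m * n := by positivity
  set δ : ℝ := 2 * (m * n * ε') with hδ
  set τ : ℝ := roundingConst m n * √ε' with hτ
  have hK : 0 < roundingConst m n := by rw [roundingConst]; positivity
  have hδ0 : 0 ≤ δ := by positivity
  have hτ0 : 0 < τ := by positivity
  have hle : ε' ≤ √ε' := Real.le_sqrt_of_sq_le (by
    rw [pow_two]; exact mul_le_of_le_one_right hε'0.le (min_le_right _ _))
  have h1 : 4 * √δ ≤ τ := by
    have e : √δ = √(2 * (m * n)) * √ε' := by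
      rw [hδ, ← mul_assoc, Real.sqrt_mul (by positivity)]
    have : 0 ≤ 16 * (n + 4 : ℝ) ^ 2 * (m * n) * √ε' := by positivity
    rw [e, hτ, roundingConst]
    linarith
  have h2 : 8 * (n + 4) ^ 2 * δ ≤ τ := by
    have e1 : 16 * (n + 4 : ℝ) ^ 2 * (m * n) * ε' ≤ 16 * (n + 4 : ℝ) ^ 2 * (m * n) * √ε' := by
      gcongr
    have e2 : 0 ≤ 4 * √(2 * (m * n)) * √ε' := by positivity
    rw [hτ, roundingConst, hδ]
    linarith
  have hS : ∀ i j, A i j ≠ 0 → 1 - δ ≤ S.bias i j := fun i j hij => S.le_bias hm hn hp' hij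
  have hbound : (2 * (n + 4 : ℕ) + 1) * √((n + (relatorWords A b).card + 1) * τ) ≤
      (2 * (n + 4 : ℕ) + 1) * √((n + (relatorWords A b).card + 1) * roundingConst m n) *
        ε ^ (1 / 4 : ℝ) := by
    rw [hτ, ← mul_assoc (_ + _ : ℝ), Real.sqrt_mul (by positivity), ← mul_assoc]
    have e : √√ε' ≤ ε ^ (1 / 4 : ℝ) := by
      rw [Real.sqrt_eq_rpow, Real.sqrt_eq_rpow, ← Real.rpow_mul hε'0.le]
      norm_num
      exact Real.rpow_le_rpow hε'0.le (min_le_left _ _) (by norm_num)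
    gcongr
  refine (hyperlinearProfile_anti _ _ _ hbound).trans ?_
  -- The rounding takes place on whichever factor realizes the minimum dimension.
  rcases min_choice (edim HA) (edim HB) with h | h
  · rw [h] at hd
    obtain ⟨hfin, hrank⟩ := finrank_of_edim_eq hd
    exact hrank ▸ S.hyperlinearProfile_le_finrank_left hδ0 hτ0 h1 h2 hS
  · rw [h] at hd
    obtain ⟨hfin, hrank⟩ := finrank_of_edim_eq hd
    exact hrank ▸ S.hyperlinearProfile_le_finrank_right hδ0 hτ0 h1 h2 hS

end LinearSystem

end

theorem corollary5p2 {m n : ℕ} (hm : 0 < m) (hn : 0 < n)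
    (A : Matrix (Fin m) (Fin n) (ZMod 2)) (b : Fin m → ZMod 2)
    (hq : LinearSystem.quantumValue A b = 1) :
    ∃ C C' : ℝ, C' ≤ C ∧ 0 < C' ∧ ∀ ε : ℝ, 0 < ε →
      hyperlinearProfile (LinearSystem.solutionRelators A b) {LinearSystem.genJ n}
          2 (C * ε ^ (1 / 4 : ℝ)) ≤ LinearSystem.entanglement A b ε ∧
      LinearSystem.entanglement A b ε ≤
        hyperlinearProfile (LinearSystem.solutionRelators A b) {LinearSystem.genJ n}
          2 (C' * Real.sqrt ε) := by
  set C₀ : ℝ := (2 * (n + 4 : ℕ) + 1) *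
    √((n + (LinearSystem.relatorWords A b).card + 1) * LinearSystem.roundingConst m n)
  set C' : ℝ := (LinearSystem.strategyConst n)⁻¹
  -- The maximum secures `C' ≤ C`; enlarging the tolerance only lowers the profile.
  refine ⟨max C₀ C', C', le_max_right _ _, inv_pos.2 (LinearSystem.strategyConst_pos n),
    fun ε hε => ⟨?_, LinearSystem.entanglement_le_hyperlinearProfile hm hn A b hq hε⟩⟩
  refine (hyperlinearProfile_anti _ _ _ ?_).trans
    (LinearSystem.hyperlinearProfile_le_entanglement hm hn A b hq hε)
  exact mul_le_mul_of_nonneg_right (le_max_left _ _) (Real.rpow_nonneg hε.le _)
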